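/- Let $k$ be an algebraically closed field and $\Lambda$ a basic finite-dimensional $k$-algebra with a complete set $e_1,\dots,e_n$ of primitive orthogonal idempotents, and let $P_i=\Lambda e_i$ be the corresponding pairwise non-isomorphic indecomposable projective left modules. Throughout, $\mathbb N=\{1,2,3,\dots\}$. A *g-vector* is an element of $K_0(\operatorname{proj}\Lambda)\cong\mathbb Z^n$ (with basis $[P_1],\dots,[P_n]$). For a g-vector $g=(g_1,\dots,g_n)$ put $P^{g+}=\bigoplus_i P_i^{\max(g_i,0)}$, $P^{g-}=\bigoplus_i P_i^{\max(-g_i,0)}$ and $\operatorname{Hom}_\Lambda(g)=\operatorname{Hom}_\Lambda(P^{g-},P^{g+})$, an affine space with its Zariski topology, whose elements are regarded as two-term complexes in degrees $-1,0$. For g-vectors $g,h$ let $$e(g,h)=\min\{\dim_k\operatorname{Hom}_{K^b(\operatorname{proj}\Lambda)}(a,b[1]) \mid a\in\operatorname{Hom}_\Lambda(g),\ b\in\operatorname{Hom}_\Lambda(h)\}.$$ If $e(g,h)=0=e(h,g)$, we write $g+h=g\oplus h$ and call $g$ and $h$ direct summands of $g+h$. A g-vector $g$ is *tame* if $2g=g\oplus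 g$ and *wild* otherwise; it is *generically indecomposable* if all elements of some dense open subset of $\operatorname{Hom}_\Lambda(g)$ are indecomposable (in particular non-zero) complexes. Let $\operatorname{ind}(g)$ be the set of generically indecomposable direct summands of $g$, and let $D_g=\{h\in K_0(\operatorname{proj}\Lambda)\mid \exists\, t\in\mathbb N,\ g+th=g\oplus th\}$. A g-vector $g$ *satisfies the non-decreasing condition* if $h\notin D_h$ for all wild $h\in\operatorname{ind}(g)$; the algebra $\Lambda$ satisfies the non-decreasing condition if all g-vectors do. **Theorem.** Let $g$ be a g-vector. (a) If $g$ satisfies the non-decreasing condition, then $\operatorname{ind}(g)$ is linearly independent, and thus $|\operatorname{ind}(g)|\le n$. (b) The following statements are equivalent: (1) $\operatorname{ind}(tg)$ is linearly independent for all $t\in\mathbb N$; (2) $tg$ satisfies the non-decreasing condition for all $t\in\mathbb N$. (c) In particular, $\Lambda$ satisfies the non-decreasing condition if and only if $\operatorname{ind}(g)$ is linearly independent for every g-vector $g$. -/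

import Mathlib

namespace GVector

section Generic

variable (k : Type*) [Field k]

/-- The Zariski topology on a vector space `V`, seen as an affine space over `k`: it has as basis
the non-vanishing loci of polynomial functions, i.e. polynomials in the linear forms on `V`. -/
@[reducible] def zariski (V : Type*) [AddCommGroup V] [Module k V] : TopologicalSpace V :=
  TopologicalSpace.generateFrom
    {U | ∃ p : MvPolynomial (Module.Dual k V) k,
      U = {v : V | MvPolynomial.eval (fun φ : Module.Dual k V => φ v) p ≠ 0}}

/-- A general element of `V` satisfies `p`: all elements of some dense Zariski-open subset do. -/
def General {V : Type*} [AddCommGroup V] [Module k V] (p : V → Prop) : Prop :=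
  ∃ U : Set V, @IsOpen V (zariski k V) U ∧ @Dense V (zariski k V) U ∧ ∀ v ∈ U, p v

end Generic

section Idempotents

variable {Λ : Type*} [Ring Λ]

/-- A primitive idempotent: non-zero, and not a sum of two non-zero orthogonal idempotents. -/
def IsPrimitiveIdempotent (e : Λ) : Prop :=
  IsIdempotentElem e ∧ e ≠ 0 ∧
    ∀ a b : Λ, IsIdempotentElem a → IsIdempotentElem b → a * b = 0 → b * a = 0 →
      e = a + b → a = 0 ∨ b = 0

/-- The indecomposable projective left module `P_i = Λ e_i`. -/
abbrev proj {n : ℕ} (e : Fin n → Λ) (i : Fin n) : Submodule Λ Λ := Submodule.span Λ {e i}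

/-- `e` is a complete set `e_1, …, e_n` of primitive orthogonal idempotents of a basic algebra:
the modules `Λ e_i` are pairwise non-isomorphic. -/
structure IsBasicSystem {n : ℕ} (e : Fin n → Λ) : Prop where
  complete : CompleteOrthogonalIdempotents e
  primitive : ∀ i, IsPrimitiveIdempotent (e i)
  basic : ∀ i j, Nonempty (proj e i ≃ₗ[Λ] proj e j) → i = j

end Idempotents

section TwoTerm

variable (k : Type*) [Field k] {Λ : Type*} [Ring Λ] [Algebra k Λ]
variable {P₁ P₀ Q₁ Q₀ : Type*}
  [AddCommGroup P₁] [Module Λ P₁] [AddCommGroup P₀] [Module Λ P₀]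
  [AddCommGroup Q₁] [Module Λ Q₁] [AddCommGroup Q₀] [Module Λ Q₀]
  [Module k Q₀] [IsScalarTower k Λ Q₀] [SMulCommClass Λ k Q₀]
  [Module k Q₁] [IsScalarTower k Λ Q₁] [SMulCommClass Λ k Q₁]

/-- Let `a : P₁ → P₀` and `b : Q₁ → Q₀` be two-term complexes in degrees `-1, 0`. The complex
`b[1]` lives in degrees `-2, -1`, so a morphism of complexes `a → b[1]` is an arbitrary map
`P₁ → Q₀`, and it is null-homotopic iff it is of the form `s ∘ a + b ∘ r` with a homotopy
`s : P₀ → Q₀`, `r : P₁ → Q₁`. -/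
def nullHomotopic (a : P₁ →ₗ[Λ] P₀) (b : Q₁ →ₗ[Λ] Q₀) : Submodule k (P₁ →ₗ[Λ] Q₀) where
  carrier := {f | ∃ (s : P₀ →ₗ[Λ] Q₀) (r : P₁ →ₗ[Λ] Q₁), f = s ∘ₗ a + b ∘ₗ r}
  zero_mem' := ⟨0, 0, by simp⟩
  add_mem' := by
    rintro _ _ ⟨s, r, rfl⟩ ⟨s', r', rfl⟩
    exact ⟨s + s', r + r', by rw [LinearMap.add_comp, LinearMap.comp_add]; abel⟩
  smul_mem' := by
    rintro c _ ⟨s, r, rfl⟩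
    refine ⟨c • s, c • r, ?_⟩
    ext x
    have h : b (c • r x) = c • b (r x) := by
      rw [← algebraMap_smul Λ c (r x), map_smul, algebraMap_smul]
    simp [h]

/-- The E-invariant `e(a, b) = dim_k Hom(a, b[1])` of two-term complexes, the morphism space being
that of the homotopy category: morphisms of complexes modulo null-homotopic ones. -/
noncomputable def eInv (a : P₁ →ₗ[Λ] P₀) (b : Q₁ →ₗ[Λ] Q₀) : ℕ :=
  Module.finrank k ((P₁ →ₗ[Λ] Q₀) ⧸ nullHomotopic k a b)

/-- The two-term complex `a : P₁ → P₀` is indecomposable: it is non-zero, and whenever it is the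
direct sum of two subcomplexes `A₁ → A₀` and `B₁ → B₀`, one of them is zero. -/
def IsIndecomposable (a : P₁ →ₗ[Λ] P₀) : Prop :=
  (Nontrivial P₁ ∨ Nontrivial P₀) ∧
    ∀ (A₁ B₁ : Submodule Λ P₁) (A₀ B₀ : Submodule Λ P₀),
      IsCompl A₁ B₁ → IsCompl A₀ B₀ → A₁.map a ≤ A₀ → B₁.map a ≤ B₀ →
        (A₁ = ⊥ ∧ A₀ = ⊥) ∨ (B₁ = ⊥ ∧ B₀ = ⊥)

end TwoTerm

section GVectors

variable (k : Type*) [Field k] {Λ : Type*} [Ring Λ] [Algebra k Λ] {n : ℕ} (e : Fin n → Λ)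

/-- The projective module `⨁ i, P_i ^ (m i)`. -/
abbrev projSum (m : Fin n → ℕ) : Type _ := (i : Fin n) → Fin (m i) → proj e i

/-- The projective module `P^{g+}` of the g-vector `g = ∑ i, g i • [P_i]`; here `K₀(proj Λ)` is
identified with `ℤⁿ` through its basis `[P_1], …, [P_n]`. -/
abbrev posProj (g : Fin n → ℤ) : Type _ := projSum e (fun i => (g i).toNat)

/-- The projective module `P^{g-}`, so that `g = [P^{g+}] - [P^{g-}]`. -/
abbrev negProj (g : Fin n → ℤ) : Type _ := projSum e (fun i => (-g i).toNat)

/-- `Hom_Λ(g) = Hom_Λ(P^{g-}, P^{g+})`. -/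
abbrev Pres (g : Fin n → ℤ) : Type _ := negProj e g →ₗ[Λ] posProj e g

/-- The E-invariant `e(g, h) = min {e(a, b) | a ∈ Hom_Λ(g), b ∈ Hom_Λ(h)}`. -/
noncomputable def eInvG (g h : Fin n → ℤ) : ℕ :=
  sInf {m | ∃ (a : Pres e g) (b : Pres e h), m = eInv k a b}

/-- `g + h = g ⊕ h`. -/
def IsDirectSum (g h : Fin n → ℤ) : Prop := eInvG k e g h = 0 ∧ eInvG k e h g = 0

/-- `g` is tame if `2 g = g ⊕ g`. -/
def IsTame (g : Fin n → ℤ) : Prop := IsDirectSum k e g g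

/-- `g` is wild if it is not tame. -/
def IsWild (g : Fin n → ℤ) : Prop := ¬ IsTame k e g

/-- `g` is generically indecomposable. -/
def GenericallyIndecomposable (g : Fin n → ℤ) : Prop :=
  General k (fun a : Pres e g => IsIndecomposable a)

/-- `h` is a direct summand of `g`: `g = h ⊕ h'` for some `h'`. -/
def IsSummand (h g : Fin n → ℤ) : Prop := ∃ h', g = h + h' ∧ IsDirectSum k e h h'

/-- `ind(g)`, the set of generically indecomposable direct summands of `g`. -/
def ind (g : Fin n → ℤ) : Set (Fin n → ℤ) :=
  {h | GenericallyIndecomposable k e h ∧ IsSummand k e h g}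

/-- `D_g`, the set of `h` with `g + t h = g ⊕ t h` for some integer `t ≥ 1`. -/
def D (g : Fin n → ℤ) : Set (Fin n → ℤ) := {h | ∃ t : ℕ, 0 < t ∧ IsDirectSum k e g (t • h)}

/-- `g` satisfies the non-decreasing condition. -/
def NonDecreasing (g : Fin n → ℤ) : Prop :=
  ∀ h ∈ ind k e g, IsWild k e h → h ∉ D k e h

/-- The algebra satisfies the non-decreasing condition. -/
def AlgebraNonDecreasing : Prop := ∀ g : Fin n → ℤ, NonDecreasing k e g

end GVectors

end GVector

/-! Call two g-vectors compatible when their sum is direct. Three facts about general elements carry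
the proof. (i) If g and h are compatible, a general element of Hom(g+h) is a direct sum of general
elements of Hom(g) and Hom(h): the map (s, r, a, b) ↦ s(a ⊕ b)r has surjective differential at (1,
1, a, b) once both extension spaces vanish, so it is dominant, and Chevalley's theorem turns
dominance into a statement about generic sets (`IsDirectSum.eventually_isom`). (ii) Hence
compatibility passes to direct summands, and by a Krull–Schmidt argument distinct members of ind(g)
are compatible (`isDirectSum_of_mem_ind`). (iii) A tame g-vector is a sum of members of its own ind
(`mem_closure_ind_of_isTame`).

Given a linear relation in ind(g), move the negative terms to the other side: f = ∑ a_y y = ∑ b_z z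
with disjoint supports. Each y on the left is compatible with every z, hence with f, hence with the
summand a_y y of f. So y ∈ D_y, and the non-decreasing condition forces y to be tame; likewise on
the right. Now both sides describe the indecomposable summands of one general element of Hom(f),
which is impossible for disjoint supports (`mem_of_add_mem_closure`).

Conversely, let h ∈ ind(f) be wild and compatible with sh, s ≥ 1. Then sh is tame, so it is a sum of
members of ind(sh), none equal to h because a summand of a tame g-vector is tame. Both h and sh are
summands of (s+1)f, so ind((s+1)f) contains h together with other vectors that sum to sh, and is
dependent (`exists_not_linearIndepOn`). This is why multiples of g enter the equivalence. -/

namespace GVector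

open Filter

/-! ### Polynomial functions and the filter of generic sets. -/

section PolynomialFunctions

variable (k : Type*) [Field k]

/-- The algebra of polynomial functions on a vector space. -/
def polyFun (V : Type*) [AddCommGroup V] [Module k V] : Subalgebra k (V → k) :=
  Algebra.adjoin k (Set.range fun φ : Module.Dual k V => (φ : V → k))

variable {k}
variable {V W : Type*} [AddCommGroup V] [Module k V] [AddCommGroup W] [Module k W]

theorem mem_polyFun_iff {f : V → k} :
    f ∈ polyFun k V ↔ ∃ p : MvPolynomial (Module.Dual k V) k,
      ∀ v, f v = MvPolynomial.eval (fun φ : Module.Dual k V => φ v) p := by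
  have key : ∀ (p : MvPolynomial (Module.Dual k V) k) (v : V),
      MvPolynomial.aeval (fun φ : Module.Dual k V => (φ : V → k)) p v =
        MvPolynomial.eval (fun φ : Module.Dual k V => φ v) p := by
    intro p v
    induction p using MvPolynomial.induction_on with
    | C a => simp
    | add p q hp hq => simp [hp, hq]
    | mul_X p φ hp => simp [hp]
  rw [polyFun, Algebra.adjoin_range_eq_range_aeval, AlgHom.mem_range]
  constructor
  · rintro ⟨p, rfl⟩
    exact ⟨p, key p⟩
  · rintro ⟨p, hp⟩
    exact ⟨p, funext fun v => (key p v).trans (hp v).symm⟩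

theorem dual_mem_polyFun (φ : Module.Dual k V) : (φ : V → k) ∈ polyFun k V :=
  Algebra.subset_adjoin ⟨φ, rfl⟩

theorem const_mem_polyFun (c : k) : (fun _ : V => c) ∈ polyFun k V :=
  (polyFun k V).algebraMap_mem c

/-- A polynomial map between vector spaces. -/
def IsPolyMap (f : V → W) : Prop := ∀ φ : Module.Dual k W, (fun v => φ (f v)) ∈ polyFun k V

theorem IsPolyMap.comp_mem {f : V → W} (hf : IsPolyMap (k := k) f) {F : W → k}
    (hF : F ∈ polyFun k W) : (fun v => F (f v)) ∈ polyFun k V := by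
  induction hF using Algebra.adjoin_induction with
  | mem x hx => obtain ⟨φ, rfl⟩ := hx; exact hf φ
  | algebraMap r => exact const_mem_polyFun r
  | add x y _ _ hx hy => exact (polyFun k V).add_mem hx hy
  | mul x y _ _ hx hy => exact (polyFun k V).mul_mem hx hy

theorem isPolyMap_linear (f : V →ₗ[k] W) : IsPolyMap (k := k) f :=
  fun φ => dual_mem_polyFun (φ ∘ₗ f)

theorem isPolyMap_const (w : W) : IsPolyMap (k := k) (fun _ : V => w) :=
  fun φ => const_mem_polyFun (φ w)

theorem IsPolyMap.add {f g : V → W} (hf : IsPolyMap (k := k) f) (hg : IsPolyMap (k := k) g) :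
    IsPolyMap (k := k) (fun v => f v + g v) := fun φ => by
  simp only [map_add]
  exact (polyFun k V).add_mem (hf φ) (hg φ)

theorem IsPolyMap.bilin {A B : Type*} [AddCommGroup A] [Module k A] [AddCommGroup B] [Module k B]
    [Module.Finite k A] [Module.Finite k B] (m : A →ₗ[k] B →ₗ[k] W) {f : V → A} {g : V → B}
    (hf : IsPolyMap (k := k) f) (hg : IsPolyMap (k := k) g) :
    IsPolyMap (k := k) (fun v => m (f v) (g v)) := fun φ => by
  let b := Module.finBasis k A
  let c := Module.finBasis k B
  have : (fun v => φ (m (f v) (g v))) =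
      ∑ i, ∑ j, (fun v => b.coord i (f v)) * (fun v => c.coord j (g v)) *
        (fun _ => φ (m (b i) (c j))) := by
    funext v
    conv_lhs => rw [← b.sum_repr (f v), ← c.sum_repr (g v)]
    simp only [map_sum, map_smul, LinearMap.sum_apply, LinearMap.smul_apply, smul_eq_mul,
      Finset.sum_apply, Pi.mul_apply, Module.Basis.coord_apply, Finset.mul_sum]
    rw [Finset.sum_comm]
    exact Finset.sum_congr rfl fun i _ => Finset.sum_congr rfl fun j _ => by ring
  rw [this]
  exact Subalgebra.sum_mem _ fun i _ => Subalgebra.sum_mem _ fun j _ =>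
    Subalgebra.mul_mem _ (Subalgebra.mul_mem _ (hf _) (hg _)) (const_mem_polyFun _)

theorem IsPolyMap.det_mem {A : Type*} [AddCommGroup A] [Module k A] [Module.Finite k A]
    {f : V → A →ₗ[k] A} (hf : IsPolyMap (k := k) f) :
    (fun v => LinearMap.det (f v)) ∈ polyFun k V := by
  let b := Module.finBasis k A
  have hentry : ∀ i j, (fun v => LinearMap.toMatrix b b (f v) i j) ∈ polyFun k V := by
    intro i j
    have := hf (b.coord i ∘ₗ LinearMap.applyₗ (b j))
    simpa [LinearMap.toMatrix_apply] using this
  have : (fun v => LinearMap.det (f v)) =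
      ∑ σ : Equiv.Perm (Fin (Module.finrank k A)), (fun _ => ((Equiv.Perm.sign σ : ℤ) : k)) *
        ∏ i, (fun v => LinearMap.toMatrix b b (f v) (σ i) i) := by
    funext v
    rw [← LinearMap.det_toMatrix b, Matrix.det_apply']
    simp [Finset.sum_apply, Finset.prod_apply]
  rw [this]
  exact Subalgebra.sum_mem _ fun σ _ => Subalgebra.mul_mem _ (const_mem_polyFun _)
    (Subalgebra.prod_mem _ fun i _ => hentry _ _)

theorem isPolyMap_line (v w : V) : IsPolyMap (k := k) (fun t : k => v + t • w) :=
  (isPolyMap_const v).add (isPolyMap_linear (LinearMap.toSpanSingleton k V w))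

theorem exists_polynomial_of_mem_polyFun {f : k → k} (hf : f ∈ polyFun k k) :
    ∃ p : Polynomial k, ∀ t, f t = p.eval t := by
  induction hf using Algebra.adjoin_induction with
  | mem x hx =>
    obtain ⟨φ, rfl⟩ := hx
    refine ⟨Polynomial.C (φ 1) * Polynomial.X, fun t => ?_⟩
    have : φ t = t * φ 1 := by
      rw [← smul_eq_mul, ← map_smul, smul_eq_mul, mul_one]
    change φ t = _
    rw [this, Polynomial.eval_mul, Polynomial.eval_C, Polynomial.eval_X, mul_comm]
  | algebraMap r => exact ⟨Polynomial.C r, fun t => by simp⟩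
  | add x y _ _ hx hy =>
    obtain ⟨p, hp⟩ := hx
    obtain ⟨q, hq⟩ := hy
    exact ⟨p + q, fun t => by simp [hp, hq]⟩
  | mul x y _ _ hx hy =>
    obtain ⟨p, hp⟩ := hx
    obtain ⟨q, hq⟩ := hy
    exact ⟨p * q, fun t => by simp [hp, hq]⟩

/-- Vector spaces over infinite fields are irreducible. -/
theorem exists_mul_ne_zero [Infinite k] {F G : V → k} (hF : F ∈ polyFun k V)
    (hG : G ∈ polyFun k V) {v w : V} (hv : F v ≠ 0) (hw : G w ≠ 0) :
    ∃ u, F u * G u ≠ 0 := by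
  -- Restrict to the line through v (t = 0) and w (t = 1), where F and G become nonzero one-variable
  -- polynomials.
  obtain ⟨p, hp⟩ := exists_polynomial_of_mem_polyFun ((isPolyMap_line v (w - v)).comp_mem hF)
  obtain ⟨q, hq⟩ := exists_polynomial_of_mem_polyFun ((isPolyMap_line v (w - v)).comp_mem hG)
  have hp0 : p ≠ 0 := by
    rintro rfl
    exact hv (by simpa using hp 0)
  have hq0 : q ≠ 0 := by
    rintro rfl
    exact hw (by simpa using hq 1)
  by_contra! h
  refine mul_ne_zero hp0 hq0 (Polynomial.funext fun t => ?_)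
  rw [Polynomial.eval_mul, ← hp, ← hq, h]
  simp

variable (k V) in
/-- The filter of subsets containing a non-empty Zariski-open set. -/
def gen [Infinite k] : Filter V where
  sets := {S | ∃ F ∈ polyFun k V, (∃ v, F v ≠ 0) ∧ ∀ v, F v ≠ 0 → v ∈ S}
  univ_sets := ⟨fun _ => 1, const_mem_polyFun 1, ⟨0, one_ne_zero⟩, fun _ _ => trivial⟩
  sets_of_superset := by
    rintro S T ⟨F, hF, hv, h⟩ hST
    exact ⟨F, hF, hv, fun v hv => hST (h v hv)⟩
  inter_sets := by
    rintro S T ⟨F, hF, ⟨v, hv⟩, hS⟩ ⟨G, hG, ⟨w, hw⟩, hT⟩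
    exact ⟨F * G, Subalgebra.mul_mem _ hF hG, exists_mul_ne_zero hF hG hv hw,
      fun u hu => ⟨hS u (left_ne_zero_of_mul hu), hT u (right_ne_zero_of_mul hu)⟩⟩

theorem eventually_gen_iff [Infinite k] {p : V → Prop} :
    (∀ᶠ v in gen k V, p v) ↔
      ∃ F ∈ polyFun k V, (∃ v, F v ≠ 0) ∧ ∀ v, F v ≠ 0 → p v := Iff.rfl

instance [Infinite k] : (gen k V).NeBot := by
  refine ⟨fun h => ?_⟩
  have : ∀ᶠ _ in gen k V, False := by simp [h]
  obtain ⟨F, -, ⟨v, hv⟩, h⟩ := eventually_gen_iff.mp this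
  exact h v hv

theorem eventually_gen_of_ne_zero [Infinite k] {F : V → k} (hF : F ∈ polyFun k V) {v : V}
    (hv : F v ≠ 0) : ∀ᶠ v in gen k V, F v ≠ 0 := ⟨F, hF, ⟨v, hv⟩, fun _ h => h⟩

theorem isTopologicalBasis_zariski :
    @TopologicalSpace.IsTopologicalBasis V (zariski k V)
      {U | ∃ F ∈ polyFun k V, U = {v | F v ≠ 0}} := by
  have hset : {U : Set V | ∃ F ∈ polyFun k V, U = {v | F v ≠ 0}} =
      {U | ∃ p : MvPolynomial (Module.Dual k V) k,
        U = {v : V | MvPolynomial.eval (fun φ : Module.Dual k V => φ v) p ≠ 0}} := by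
    ext U
    constructor
    · rintro ⟨F, hF, rfl⟩
      obtain ⟨p, hp⟩ := mem_polyFun_iff.mp hF
      exact ⟨p, by simp [hp]⟩
    · rintro ⟨p, rfl⟩
      exact ⟨_, mem_polyFun_iff.mpr ⟨p, fun _ => rfl⟩, rfl⟩
  let _ := zariski k V
  refine ⟨?_, ?_, by rw [hset]⟩
  · rintro _ ⟨F, hF, rfl⟩ _ ⟨G, hG, rfl⟩ v ⟨hv, hw⟩
    refine ⟨_, ⟨F * G, Subalgebra.mul_mem _ hF hG, rfl⟩, mul_ne_zero hv hw, fun u hu => ?_⟩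
    exact ⟨left_ne_zero_of_mul hu, right_ne_zero_of_mul hu⟩
  · refine Set.eq_univ_of_forall fun v => ⟨_, ⟨_, const_mem_polyFun 1, rfl⟩, ?_⟩
    exact one_ne_zero (α := k)

/-- By irreducibility every nonempty open set is dense, so density only has to be checked as
nonemptiness, and generic properties can be handled as a filter. -/
theorem general_iff [Infinite k] {p : V → Prop} :
    General k p ↔ ∀ᶠ v in gen k V, p v := by
  let _ := zariski k V
  have hB := isTopologicalBasis_zariski (k := k) (V := V)
  constructor
  · rintro ⟨U, hU, hd, h⟩
    obtain ⟨v, hv⟩ := hd.nonempty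
    obtain ⟨_, ⟨F, hF, rfl⟩, hvF, hFU⟩ := hB.exists_subset_of_mem_open hv hU
    exact ⟨F, hF, ⟨v, hvF⟩, fun w hw => h w (hFU hw)⟩
  · rintro ⟨F, hF, ⟨v, hv⟩, h⟩
    refine ⟨{v | F v ≠ 0}, hB.isOpen ⟨F, hF, rfl⟩, ?_, h⟩
    rw [hB.dense_iff]
    rintro _ ⟨G, hG, rfl⟩ ⟨w, hw⟩
    obtain ⟨u, hu⟩ := exists_mul_ne_zero hF hG hv hw
    exact ⟨u, right_ne_zero_of_mul hu, left_ne_zero_of_mul hu⟩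

theorem tendsto_gen [Infinite k] {f : V → W} (hf : IsPolyMap (k := k) f)
    (hsurj : Function.Surjective f) : Tendsto f (gen k V) (gen k W) := by
  rintro S ⟨F, hF, ⟨w, hw⟩, h⟩
  obtain ⟨v, rfl⟩ := hsurj w
  exact ⟨_, hf.comp_mem hF, ⟨v, hw⟩, fun u hu => h _ hu⟩

/-- Fix a linear section σ of f v: the determinant of f u ∘ σ is polynomial in u and equals 1 at v,
and f u is surjective wherever it is nonzero. -/
theorem eventually_surjective [Infinite k] {A B : Type*} [AddCommGroup A] [Module k A]
    [AddCommGroup B] [Module k B] [Module.Finite k A] [Module.Finite k B]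
    {f : V → A →ₗ[k] B} (hf : IsPolyMap (k := k) f) {v : V} (hv : Function.Surjective (f v)) :
    ∀ᶠ u in gen k V, Function.Surjective (f u) := by
  obtain ⟨σ, hσ⟩ := (f v).exists_rightInverse_of_surjective (LinearMap.range_eq_top.mpr hv)
  have hpoly : IsPolyMap (k := k) fun u => f u ∘ₗ σ := fun φ =>
    hf (φ ∘ₗ LinearMap.lcomp k B σ)
  refine (eventually_gen_of_ne_zero hpoly.det_mem (v := v) (by simp [hσ])).mono fun u hu => ?_
  have := (LinearMap.equivOfDetNeZero (f u ∘ₗ σ) hu).surjective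
  exact Function.Surjective.of_comp (g := σ) this

end PolynomialFunctions

/-! ### Dominance from a surjective differential. -/

section Dominance

variable {k : Type*} [Field k]
variable {V W : Type*} [AddCommGroup V] [Module k V] [AddCommGroup W] [Module k W]

/-- Evaluation of polynomial functions at a point. -/
def evalAt (w : W) : polyFun k W →+* k :=
  (Pi.evalRingHom (fun _ : W => k) w).comp (polyFun k W).val.toRingHom

@[simp] theorem evalAt_apply (w : W) (f : polyFun k W) : evalAt w f = f.1 w := rfl

/-- The expansion is in t alone, with coefficients that are polynomial functions of the direction w,
so that the lowest nonzero coefficient can be extracted uniformly in w. -/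
theorem exists_taylor {F : W → k} (hF : F ∈ polyFun k W) (x : W) :
    ∃ P : Polynomial (polyFun k W), ∀ (t : k) (w : W),
      F (x + t • w) = P.eval₂ (evalAt w) t := by
  induction hF using Algebra.adjoin_induction with
  | mem f hf =>
    obtain ⟨φ, rfl⟩ := hf
    refine ⟨Polynomial.C ⟨_, const_mem_polyFun (φ x)⟩ +
      Polynomial.X * Polynomial.C ⟨φ, dual_mem_polyFun φ⟩, fun t w => ?_⟩
    simpa using mul_comm _ _
  | algebraMap r => exact ⟨Polynomial.C ⟨_, const_mem_polyFun r⟩, fun t w => by simp⟩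
  | add f g _ _ hf hg =>
    obtain ⟨P, hP⟩ := hf
    obtain ⟨Q, hQ⟩ := hg
    exact ⟨P + Q, fun t w => by simp [hP, hQ, Polynomial.eval₂_add]⟩
  | mul f g _ _ hf hg =>
    obtain ⟨P, hP⟩ := hf
    obtain ⟨Q, hQ⟩ := hg
    exact ⟨P * Q, fun t w => by simp [hP, hQ, Polynomial.eval₂_mul]⟩

/-- A polynomial map whose differential at some point is surjective is dominant. -/
theorem exists_comp_ne_zero_of_tangent [Infinite k] [Module.Finite k W] {φ : V → W} (p : V)
    (hφ : ∀ w, ∃ v y z, ∀ t : k, φ (p + t • v) = φ p + t • (w + t • (y + t • z)))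
    {F : W → k} (hF : F ∈ polyFun k W) {w₀ : W} (hw₀ : F w₀ ≠ 0) : ∃ v, F (φ v) ≠ 0 := by
  obtain ⟨P, hP⟩ := exists_taylor hF (φ p)
  have hP0 : P ≠ 0 := by
    rintro rfl
    apply hw₀
    simpa using hP 1 (w₀ - φ p)
  -- Write P = X ^ N * Q with Q having nonzero constant term, and pick a direction w at which that
  -- term does not vanish.
  obtain ⟨Q, hQ, hQ0⟩ := Polynomial.exists_eq_pow_rootMultiplicity_mul_and_not_dvd P hP0 0
  generalize Polynomial.rootMultiplicity 0 P = N at hQ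
  rw [map_zero, sub_zero, Polynomial.X_dvd_iff] at hQ0
  obtain ⟨w, hw⟩ : ∃ w, (Q.coeff 0).1 w ≠ 0 := by
    by_contra! h
    exact hQ0 (Subtype.ext (funext h))
  obtain ⟨v, y, z, hv⟩ := hφ w
  have hid : IsPolyMap (k := k) fun t : k => t := isPolyMap_linear LinearMap.id
  -- Along p + t v the value of F ∘ φ is t ^ N times Q evaluated at t and at the moving direction w
  -- + t(y + t z). At t = 0 this second factor is nonzero, so it is nonzero at some t ≠ 0 as well.
  have hpath : IsPolyMap (k := k) fun t : k => w + t • (y + t • z) :=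
    (isPolyMap_const w).add (IsPolyMap.bilin (LinearMap.lsmul k W) hid (isPolyMap_line y z))
  have hH : (fun t : k => Q.eval₂ (evalAt (w + t • (y + t • z))) t) ∈
      polyFun k k := by
    have : (fun t : k => Q.eval₂ (evalAt (w + t • (y + t • z))) t) =
        ∑ i ∈ Q.support, (fun t => (Q.coeff i).1 (w + t • (y + t • z))) * (fun t => t) ^ i := by
      funext t
      simp [Polynomial.eval₂_eq_sum, Polynomial.sum, Finset.sum_apply]
    rw [this]
    exact Subalgebra.sum_mem _ fun i _ => Subalgebra.mul_mem _
      (hpath.comp_mem (Q.coeff i).2) (Subalgebra.pow_mem _ (hid LinearMap.id) i)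
  obtain ⟨t, ht⟩ := exists_mul_ne_zero hH (hid LinearMap.id) (v := 0) (w := 1)
    (by simpa [Polynomial.eval₂_at_zero] using hw) (by simp)
  refine ⟨p + t • v, ?_⟩
  rw [hv, hP, hQ, Polynomial.eval₂_mul]
  refine mul_ne_zero ?_ (left_ne_zero_of_mul ht)
  simpa using pow_ne_zero N (right_ne_zero_of_mul ht)

end Dominance

/-! ### Nullstellensatz and Chevalley's theorem for polynomial maps. -/

section Chevalley

variable {k : Type*} [Field k]
variable {V W : Type*} [AddCommGroup V] [Module k V] [AddCommGroup W] [Module k W]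

instance [Infinite k] : IsDomain (polyFun k V) := by
  have : NoZeroDivisors (polyFun k V) := by
    refine ⟨fun {f g} hfg => ?_⟩
    by_contra! h
    obtain ⟨v, hv⟩ : ∃ v, f.1 v ≠ 0 := by
      by_contra! h'
      exact h.1 (Subtype.ext (funext h'))
    obtain ⟨w, hw⟩ : ∃ v, g.1 v ≠ 0 := by
      by_contra! h'
      exact h.2 (Subtype.ext (funext h'))
    obtain ⟨u, hu⟩ := exists_mul_ne_zero f.2 g.2 hv hw
    exact hu (congrFun (congrArg Subtype.val hfg) u)
  exact NoZeroDivisors.to_isDomain _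

instance [Module.Finite k V] : Algebra.FiniteType k (polyFun k V) := by
  rw [← Subalgebra.fg_iff_finiteType]
  let b := Module.finBasis k V
  have : polyFun k V = Algebra.adjoin k (Set.range fun i => (b.coord i : V → k)) := by
    refine le_antisymm (Algebra.adjoin_le ?_) (Algebra.adjoin_mono ?_)
    · rintro _ ⟨φ, rfl⟩
      have : (φ : V → k) = ∑ i, φ (b i) • (b.coord i : V → k) := by
        funext v
        conv_lhs => rw [← b.sum_repr v]
        simp only [map_sum, map_smul, Finset.sum_apply, Pi.smul_apply, smul_eq_mul,
          Module.Basis.coord_apply]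
        exact Finset.sum_congr rfl fun i _ => mul_comm _ _
      change (φ : V → k) ∈ _
      rw [this]
      exact Subalgebra.sum_mem _ fun i _ => Subalgebra.smul_mem _
        (Algebra.subset_adjoin (Set.mem_range_self i)) _
    · rintro _ ⟨i, rfl⟩
      exact ⟨b.coord i, rfl⟩
  rw [this]
  exact Subalgebra.fg_def.mpr ⟨_, Set.finite_range _, rfl⟩

/-- By Zariski's lemma B/m is a finite extension of k, hence k itself. -/
theorem exists_algHom_ker_eq {B : Type*} [CommRing B] [Algebra k B] [Algebra.FiniteType k B]
    [IsAlgClosed k] (m : Ideal B) [m.IsMaximal] : ∃ χ : B →ₐ[k] k, ∀ f, χ f = 0 ↔ f ∈ m := by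
  let _ : Field (B ⧸ m) := Ideal.Quotient.field m
  have : Module.Finite k (B ⧸ m) := finite_of_finite_type_of_isJacobsonRing k _
  let ε : k ≃ₐ[k] B ⧸ m := AlgEquiv.ofBijective (Algebra.ofId k _)
    IsAlgClosed.algebraMap_bijective_of_isIntegral
  refine ⟨(ε.symm : B ⧸ m →ₐ[k] k).comp (Ideal.Quotient.mkₐ k m), fun f => ?_⟩
  change ε.symm (Ideal.Quotient.mk m f) = 0 ↔ _
  rw [EmbeddingLike.map_eq_zero_iff, Ideal.Quotient.eq_zero_iff_mem]

/-- The Nullstellensatz: maximal ideals of the algebra of polynomial functions are points. -/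
theorem exists_point_of_isMaximal [IsAlgClosed k] [Module.Finite k V] (m : Ideal (polyFun k V))
    [m.IsMaximal] : ∃ v : V, ∀ f : polyFun k V, f ∈ m ↔ f.1 v = 0 := by
  obtain ⟨χ, hχm⟩ := exists_algHom_ker_eq (k := k) m
  -- The character χ restricted to linear forms lies in the double dual, which is V by finite
  -- dimension.
  let ψ : Module.Dual k (Module.Dual k V) :=
    { toFun := fun φ => χ ⟨φ, dual_mem_polyFun φ⟩
      map_add' := fun φ φ' => by rw [← map_add]; rfl
      map_smul' := fun c φ => by rw [RingHom.id_apply, ← map_smul]; rfl }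
  let v := (Module.evalEquiv k V).symm ψ
  have hχ : ∀ f (hf : f ∈ polyFun k V), χ ⟨f, hf⟩ = f v := by
    intro f hf
    induction hf using Algebra.adjoin_induction with
    | mem f hf =>
      obtain ⟨φ, rfl⟩ := hf
      change ψ φ = φ v
      simp [v]
    | algebraMap r => exact χ.commutes r
    | add f g hf hg hf' hg' =>
      rw [Pi.add_apply, ← hf', ← hg', ← map_add]
      rfl
    | mul f g hf hg hf' hg' =>
      rw [Pi.mul_apply, ← hf', ← hg', ← map_mul]
      rfl
  refine ⟨v, fun f => ?_⟩
  rw [← hχ f.1 f.2]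
  exact (hχm f).symm

/-- Chevalley's theorem: a dominant polynomial map sends generic sets to generic sets. -/
theorem gen_le_map [IsAlgClosed k] [Module.Finite k V] [Module.Finite k W] {φ : V → W}
    (hφ : IsPolyMap (k := k) φ)
    (hdom : ∀ F ∈ polyFun k W, ∀ w, F w ≠ 0 → ∃ v, F (φ v) ≠ 0) :
    gen k W ≤ (gen k V).map φ := by
  refine le_map fun S hS => ?_
  obtain ⟨d, hd, ⟨v₀, hv₀⟩, hdS⟩ := hS
  let Φ : polyFun k W →ₐ[k] polyFun k V :=
    { toFun := fun F => ⟨fun v => F.1 (φ v), hφ.comp_mem F.2⟩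
      map_one' := rfl
      map_mul' := fun _ _ => rfl
      map_zero' := rfl
      map_add' := fun _ _ => rfl
      commutes' := fun _ => rfl }
  have hinj : Function.Injective Φ := by
    rw [injective_iff_map_eq_zero]
    intro F hF
    by_contra h
    obtain ⟨w, hw⟩ : ∃ w, F.1 w ≠ 0 := by
      by_contra! h'
      exact h (Subtype.ext (funext h'))
    obtain ⟨v, hv⟩ := hdom F.1 F.2 w hw
    exact hv (congrFun (congrArg Subtype.val hF) v)
  have hNoeth : IsNoetherianRing (polyFun k W) := Algebra.FiniteType.isNoetherianRing k _
  have hJac : IsJacobsonRing (polyFun k V) := isJacobsonRing_of_finiteType (A := k)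
  have hfp : (Φ : polyFun k W →+* polyFun k V).FinitePresentation := by
    rw [← RingHom.FinitePresentation.of_finiteType]
    have h1 : ((Φ : polyFun k W →+* polyFun k V).comp (algebraMap k _)).FiniteType := by
      rw [AlgHom.comp_algebraMap_of_tower]
      exact RingHom.finiteType_algebraMap.mpr inferInstance
    exact RingHom.FiniteType.of_comp_finiteType h1
  let D : polyFun k V := ⟨d, hd⟩
  have hD : D ≠ 0 := fun h => hv₀ (congrFun (congrArg Subtype.val h) v₀)
  -- The image of the basic open set of D is constructible, and it contains the generic point
  -- because Φ is injective.
  obtain ⟨C, hC⟩ := PrimeSpectrum.exists_constructibleSetData_iff.mpr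
    (PrimeSpectrum.isConstructible_comap_image hfp
      (PrimeSpectrum.isConstructible_basicOpen (f := D)))
  let η : PrimeSpectrum (polyFun k W) := ⟨⊥, Ideal.isPrime_bot⟩
  have hη : η ∈ C.toSet := by
    rw [hC]
    refine ⟨⟨⊥, Ideal.isPrime_bot⟩, ?_, ?_⟩
    · simpa [PrimeSpectrum.mem_basicOpen] using hD
    · ext F
      simp only [PrimeSpectrum.comap_asIdeal, Ideal.mem_comap, Ideal.mem_bot, η]
      exact map_eq_zero_iff Φ hinj
  simp only [PrimeSpectrum.ConstructibleSetData.toSet, Set.mem_iUnion] at hη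
  obtain ⟨c, hcC, hc⟩ := hη
  -- The generic point is the zero ideal and lies in this piece V(g) ∖ V(f), so every g i is zero
  -- and the piece is the basic open set of f.
  have hf : c.f ≠ 0 := by
    intro h
    exact hc.2 (by simp [h])
  have hg : ∀ i, c.g i = 0 := fun i => by
    have := hc.1 ⟨i, rfl⟩
    simpa [η] using this
  obtain ⟨w₀, hw₀⟩ : ∃ w, c.f.1 w ≠ 0 := by
    by_contra! h'
    exact hf (Subtype.ext (funext h'))
  refine ⟨c.f.1, c.f.2, ⟨w₀, hw₀⟩, fun w hw => ?_⟩
  let y : PrimeSpectrum (polyFun k W) := ⟨RingHom.ker (evalAt (k := k) w), RingHom.ker_isPrime _⟩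
  have hy : y ∈ C.toSet := by
    simp only [PrimeSpectrum.ConstructibleSetData.toSet, Set.mem_iUnion]
    refine ⟨c, hcC, ?_, ?_⟩
    · rintro _ ⟨i, rfl⟩
      rw [hg]
      exact Ideal.zero_mem _
    · simpa [PrimeSpectrum.mem_zeroLocus, y] using hw
  rw [hC] at hy
  obtain ⟨q, hq, hqy⟩ := hy
  -- A prime q over the point w avoids D; by the Jacobson property so does some maximal ideal m ⊇ q,
  -- that is, some point v of V. Linear forms shifted to vanish at w then show φ v = w.
  have hDq : D ∉ q.asIdeal.jacobson := by
    rw [hJac.out q.isPrime.isRadical]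
    exact hq
  rw [Ideal.jacobson, Submodule.mem_sInf] at hDq
  push Not at hDq
  obtain ⟨m, ⟨hqm, hm⟩, hDm⟩ := hDq
  obtain ⟨v, hv⟩ := exists_point_of_isMaximal m
  refine ⟨v, hdS v fun h => hDm ((hv D).mpr h), ?_⟩
  rw [← sub_eq_zero]
  refine (Module.forall_dual_apply_eq_zero_iff k _).mp fun ℓ => ?_
  let F : polyFun k W := ⟨ℓ, dual_mem_polyFun ℓ⟩ - algebraMap k _ (ℓ w)
  have hF : F ∈ y.asIdeal := by
    simp only [y, RingHom.mem_ker]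
    change ℓ w - ℓ w = 0
    simp
  rw [← hqy] at hF
  have := (hv _).mp (hqm hF)
  rw [map_sub]
  exact this

end Chevalley

/-! ### Retracts, extensions and Fitting's lemma for two-term complexes. -/

section Complexes

variable {Λ : Type*} [Ring Λ]
variable {P₁ P₀ Q₁ Q₀ X₁ X₀ Y₁ Y₀ : Type*}
  [AddCommGroup P₁] [Module Λ P₁] [AddCommGroup P₀] [Module Λ P₀]
  [AddCommGroup Q₁] [Module Λ Q₁] [AddCommGroup Q₀] [Module Λ Q₀]
  [AddCommGroup X₁] [Module Λ X₁] [AddCommGroup X₀] [Module Λ X₀]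
  [AddCommGroup Y₁] [Module Λ Y₁] [AddCommGroup Y₀] [Module Λ Y₀]

/-- The two-term complex `a` is a retract of `x`. -/
def Retract (a : P₁ →ₗ[Λ] P₀) (x : X₁ →ₗ[Λ] X₀) : Prop :=
  ∃ (i₁ : P₁ →ₗ[Λ] X₁) (i₀ : P₀ →ₗ[Λ] X₀) (p₁ : X₁ →ₗ[Λ] P₁) (p₀ : X₀ →ₗ[Λ] P₀),
    (∀ v, x (i₁ v) = i₀ (a v)) ∧ (∀ v, a (p₁ v) = p₀ (x v)) ∧
      (∀ v, p₁ (i₁ v) = v) ∧ ∀ v, p₀ (i₀ v) = v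

/-- Two-term complexes are isomorphic. -/
def Isom (a : P₁ →ₗ[Λ] P₀) (x : X₁ →ₗ[Λ] X₀) : Prop :=
  ∃ (u₁ : P₁ ≃ₗ[Λ] X₁) (u₀ : P₀ ≃ₗ[Λ] X₀), ∀ v, x (u₁ v) = u₀ (a v)

/-- All morphisms of complexes from `a` to `b[1]` are null-homotopic. -/
def ExtVanish (a : P₁ →ₗ[Λ] P₀) (b : Q₁ →ₗ[Λ] Q₀) : Prop :=
  ∀ f : P₁ →ₗ[Λ] Q₀, ∃ (s : P₀ →ₗ[Λ] Q₀) (r : P₁ →ₗ[Λ] Q₁), ∀ v, f v = s (a v) + b (r v)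

theorem Isom.symm {a : P₁ →ₗ[Λ] P₀} {x : X₁ →ₗ[Λ] X₀} (h : Isom a x) : Isom x a := by
  obtain ⟨u₁, u₀, h⟩ := h
  refine ⟨u₁.symm, u₀.symm, fun v => ?_⟩
  rw [LinearEquiv.eq_symm_apply, ← h, LinearEquiv.apply_symm_apply]

theorem Isom.trans {a : P₁ →ₗ[Λ] P₀} {b : Q₁ →ₗ[Λ] Q₀} {x : X₁ →ₗ[Λ] X₀} (h : Isom a b)
    (h' : Isom b x) : Isom a x := by
  obtain ⟨u₁, u₀, h⟩ := h
  obtain ⟨w₁, w₀, h'⟩ := h'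
  exact ⟨u₁.trans w₁, u₀.trans w₀, fun v => by simp [h', h]⟩

theorem Isom.retract {a : P₁ →ₗ[Λ] P₀} {x : X₁ →ₗ[Λ] X₀} (h : Isom a x) : Retract a x := by
  obtain ⟨u₁, u₀, h⟩ := h
  refine ⟨u₁, u₀, u₁.symm, u₀.symm, h, fun v => ?_, by simp, by simp⟩
  simp only [LinearEquiv.coe_coe]
  rw [LinearEquiv.eq_symm_apply, ← h, LinearEquiv.apply_symm_apply]

theorem Retract.trans {a : P₁ →ₗ[Λ] P₀} {b : Q₁ →ₗ[Λ] Q₀} {x : X₁ →ₗ[Λ] X₀} (h : Retract a b)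
    (h' : Retract b x) : Retract a x := by
  obtain ⟨i₁, i₀, p₁, p₀, h1, h2, h3, h4⟩ := h
  obtain ⟨j₁, j₀, q₁, q₀, h1', h2', h3', h4'⟩ := h'
  exact ⟨j₁ ∘ₗ i₁, j₀ ∘ₗ i₀, p₁ ∘ₗ q₁, p₀ ∘ₗ q₀, by simp [h1', h1], by simp [h2, h2'],
    by simp [h3', h3], by simp [h4', h4]⟩

theorem retract_prodMap_left (a : P₁ →ₗ[Λ] P₀) (b : Q₁ →ₗ[Λ] Q₀) : Retract a (a.prodMap b) :=
  ⟨.inl Λ _ _, .inl Λ _ _, .fst Λ _ _, .fst Λ _ _, by simp, by simp, by simp, by simp⟩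

theorem retract_prodMap_right (a : P₁ →ₗ[Λ] P₀) (b : Q₁ →ₗ[Λ] Q₀) : Retract b (a.prodMap b) :=
  ⟨.inr Λ _ _, .inr Λ _ _, .snd Λ _ _, .snd Λ _ _, by simp, by simp, by simp, by simp⟩

theorem ExtVanish.of_retract_left {a : P₁ →ₗ[Λ] P₀} {b : Q₁ →ₗ[Λ] Q₀} {x : X₁ →ₗ[Λ] X₀}
    (h : Retract a x) (hx : ExtVanish x b) : ExtVanish a b := by
  obtain ⟨i₁, i₀, p₁, p₀, h1, h2, h3, h4⟩ := h
  intro f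
  obtain ⟨s, r, h⟩ := hx (f ∘ₗ p₁)
  refine ⟨s ∘ₗ i₀, r ∘ₗ i₁, fun v => ?_⟩
  simpa [h1, h3] using h (i₁ v)

theorem ExtVanish.of_retract_right {a : P₁ →ₗ[Λ] P₀} {b : Q₁ →ₗ[Λ] Q₀} {x : X₁ →ₗ[Λ] X₀}
    (h : Retract b x) (hx : ExtVanish a x) : ExtVanish a b := by
  obtain ⟨i₁, i₀, p₁, p₀, h1, h2, h3, h4⟩ := h
  intro f
  obtain ⟨s, r, h⟩ := hx (i₀ ∘ₗ f)
  refine ⟨p₀ ∘ₗ s, p₁ ∘ₗ r, fun v => ?_⟩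
  simpa [h2, h4] using congrArg p₀ (h v)

theorem ExtVanish.prod_left {a : P₁ →ₗ[Λ] P₀} {b : Q₁ →ₗ[Λ] Q₀} {x : X₁ →ₗ[Λ] X₀}
    (ha : ExtVanish a x) (hb : ExtVanish b x) : ExtVanish (a.prodMap b) x := by
  intro f
  obtain ⟨s, r, h⟩ := ha (f ∘ₗ .inl Λ _ _)
  obtain ⟨s', r', h'⟩ := hb (f ∘ₗ .inr Λ _ _)
  refine ⟨s.coprod s', r.coprod r', fun v => ?_⟩
  have h1 := h v.1
  have h2 := h' v.2
  have hv : f v = f (v.1, 0) + f (0, v.2) := by rw [← map_add]; simp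
  simp only [LinearMap.comp_apply, LinearMap.inl_apply, LinearMap.inr_apply] at h1 h2
  rw [hv, h1, h2]
  simp only [LinearMap.prodMap_apply, LinearMap.coprod_apply, map_add]
  abel

theorem ExtVanish.prod_right {a : P₁ →ₗ[Λ] P₀} {b : Q₁ →ₗ[Λ] Q₀} {x : X₁ →ₗ[Λ] X₀}
    (ha : ExtVanish x a) (hb : ExtVanish x b) : ExtVanish x (a.prodMap b) := by
  intro f
  obtain ⟨s, r, h⟩ := ha (.fst Λ _ _ ∘ₗ f)
  obtain ⟨s', r', h'⟩ := hb (.snd Λ _ _ ∘ₗ f)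
  refine ⟨s.prod s', r.prod r', fun v => ?_⟩
  ext
  · simpa using h v
  · simpa using h' v

/-- Fitting's lemma for two-term complexes. -/
theorem IsIndecomposable.bijective_or [IsNoetherian Λ P₁] [IsArtinian Λ P₁] [IsNoetherian Λ P₀]
    [IsArtinian Λ P₀] {a : P₁ →ₗ[Λ] P₀} (ha : IsIndecomposable a)
    {φ₁ ψ₁ : Module.End Λ P₁} {φ₀ ψ₀ : Module.End Λ P₀} (hφ : ∀ v, a (φ₁ v) = φ₀ (a v))
    (h₁ : φ₁ + ψ₁ = 1) (h₀ : φ₀ + ψ₀ = 1) :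
    (Function.Bijective φ₁ ∧ Function.Bijective φ₀) ∨
      (Function.Bijective ψ₁ ∧ Function.Bijective ψ₀) := by
  obtain ⟨N, hN, hN₁, hN₀⟩ := ((eventually_ge_atTop 1).and
    ((φ₁.eventually_isCompl_ker_pow_range_pow).and
      (φ₀.eventually_isCompl_ker_pow_range_pow))).exists
  have hpow : ∀ m v, a ((φ₁ ^ m) v) = (φ₀ ^ m) (a v) := by
    intro m
    induction m with
    | zero => simp
    | succ m ih =>
      intro v
      rw [pow_succ, pow_succ, Module.End.mul_apply, Module.End.mul_apply, ih, hφ]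
  -- The same N works in both degrees, so kernel and range of the N-th powers are complementary
  -- subcomplexes and one of them is zero.
  have hker : (LinearMap.ker (φ₁ ^ N)).map a ≤ LinearMap.ker (φ₀ ^ N) := by
    rintro _ ⟨v, hv, rfl⟩
    have hv' : (φ₁ ^ N) v = 0 := hv
    rw [LinearMap.mem_ker, ← hpow, hv', map_zero]
  have hrange : (LinearMap.range (φ₁ ^ N)).map a ≤ LinearMap.range (φ₀ ^ N) := by
    rintro _ ⟨_, ⟨v, rfl⟩, rfl⟩
    exact ⟨a v, (hpow N v).symm⟩
  rcases ha.2 _ _ _ _ hN₁ hN₀ hker hrange with ⟨hk₁, hk₀⟩ | ⟨hr₁, hr₀⟩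
  · left
    constructor
    · refine IsArtinian.bijective_of_injective_endomorphism _ ?_
      rw [← LinearMap.ker_eq_bot, eq_bot_iff, ← hk₁]
      intro v hv
      exact Module.End.pow_map_zero_of_le (f := φ₁) (k := 1) hN (by simpa using hv)
    · refine IsArtinian.bijective_of_injective_endomorphism _ ?_
      rw [← LinearMap.ker_eq_bot, eq_bot_iff, ← hk₀]
      intro v hv
      exact Module.End.pow_map_zero_of_le (f := φ₀) (k := 1) hN (by simpa using hv)
  · right
    -- Zero range means that φ is nilpotent, so ψ = 1 - φ is a unit.
    rw [LinearMap.range_eq_bot] at hr₁ hr₀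
    rw [← Module.End.isUnit_iff, ← Module.End.isUnit_iff, eq_sub_iff_add_eq'.mpr h₁,
      eq_sub_iff_add_eq'.mpr h₀]
    exact ⟨IsNilpotent.isUnit_one_sub ⟨N, hr₁⟩, IsNilpotent.isUnit_one_sub ⟨N, hr₀⟩⟩

/-- Correct the projections by the inverse of p ∘ i, which is again a morphism of complexes. -/
theorem Retract.of_bijective {a : P₁ →ₗ[Λ] P₀} {x : X₁ →ₗ[Λ] X₀} {i₁ : P₁ →ₗ[Λ] X₁}
    {i₀ : P₀ →ₗ[Λ] X₀} {p₁ : X₁ →ₗ[Λ] P₁} {p₀ : X₀ →ₗ[Λ] P₀} (hi : ∀ v, x (i₁ v) = i₀ (a v))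
    (hp : ∀ v, a (p₁ v) = p₀ (x v)) (h₁ : Function.Bijective (p₁ ∘ₗ i₁))
    (h₀ : Function.Bijective (p₀ ∘ₗ i₀)) : Retract a x := by
  let u₁ := LinearEquiv.ofBijective _ h₁
  let u₀ := LinearEquiv.ofBijective _ h₀
  have hu₁ : ∀ v, u₁ v = p₁ (i₁ v) := fun v => rfl
  have hu₀ : ∀ v, u₀ v = p₀ (i₀ v) := fun v => rfl
  refine ⟨i₁, i₀, u₁.symm.toLinearMap ∘ₗ p₁, u₀.symm.toLinearMap ∘ₗ p₀, hi, fun v => ?_,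
    fun v => ?_, fun v => ?_⟩
  · simp only [LinearMap.comp_apply, LinearEquiv.coe_coe]
    rw [LinearEquiv.eq_symm_apply, hu₀, ← hi, ← hp, ← hu₁, LinearEquiv.apply_symm_apply, hp]
  · simp only [LinearMap.comp_apply, LinearEquiv.coe_coe]
    rw [← hu₁, LinearEquiv.symm_apply_apply]
  · simp only [LinearMap.comp_apply, LinearEquiv.coe_coe]
    rw [← hu₀, LinearEquiv.symm_apply_apply]

/-- An indecomposable retract of a direct sum is a retract of one of the summands. -/
theorem IsIndecomposable.retract_or [IsNoetherian Λ P₁] [IsArtinian Λ P₁] [IsNoetherian Λ P₀]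
    [IsArtinian Λ P₀] {a : P₁ →ₗ[Λ] P₀} (ha : IsIndecomposable a) {x : X₁ →ₗ[Λ] X₀}
    {y : Y₁ →ₗ[Λ] Y₀} (h : Retract a (x.prodMap y)) : Retract a x ∨ Retract a y := by
  obtain ⟨i₁, i₀, p₁, p₀, h1, h2, h3, h4⟩ := h
  have hx1 : ∀ v, x (i₁ v).1 = (i₀ (a v)).1 := fun v => congrArg Prod.fst (h1 v)
  have hy1 : ∀ v, y (i₁ v).2 = (i₀ (a v)).2 := fun v => congrArg Prod.snd (h1 v)
  have hx2 : ∀ v, a (p₁ (v, 0)) = p₀ (x v, 0) := fun v => by simpa using h2 (v, 0)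
  have hy2 : ∀ v, a (p₁ (0, v)) = p₀ (0, y v) := fun v => by simpa using h2 (0, v)
  -- The endomorphisms of a that factor through x and through y add up to the identity.
  have key := ha.bijective_or (φ₁ := (p₁ ∘ₗ .inl Λ _ _) ∘ₗ (.fst Λ _ _ ∘ₗ i₁))
    (ψ₁ := (p₁ ∘ₗ .inr Λ _ _) ∘ₗ (.snd Λ _ _ ∘ₗ i₁))
    (φ₀ := (p₀ ∘ₗ .inl Λ _ _) ∘ₗ (.fst Λ _ _ ∘ₗ i₀))
    (ψ₀ := (p₀ ∘ₗ .inr Λ _ _) ∘ₗ (.snd Λ _ _ ∘ₗ i₀))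
    (fun v => by simp [hx2, hx1])
    (LinearMap.ext fun v => by simp [← map_add, h3])
    (LinearMap.ext fun v => by simp [← map_add, h4])
  rcases key with ⟨h₁, h₀⟩ | ⟨h₁, h₀⟩
  · exact Or.inl (Retract.of_bijective (by simp [hx1]) (by simp [hx2]) h₁ h₀)
  · exact Or.inr (Retract.of_bijective (by simp [hy1]) (by simp [hy2]) h₁ h₀)

theorem isCompl_range_ker {i : P₁ →ₗ[Λ] Q₁} {p : Q₁ →ₗ[Λ] P₁} (h : ∀ v, p (i v) = v) :
    IsCompl (LinearMap.range i) (LinearMap.ker p) := by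
  refine ⟨Submodule.disjoint_def.mpr ?_, codisjoint_iff.mpr (eq_top_iff.mpr fun v _ => ?_)⟩
  · rintro _ ⟨v, rfl⟩ hv
    rw [LinearMap.mem_ker, h] at hv
    rw [hv, map_zero]
  · exact Submodule.mem_sup.mpr ⟨i (p v), ⟨_, rfl⟩, v - i (p v), by simp [h], by abel⟩

/-- A non-zero retract of an indecomposable complex is isomorphic to it. -/
theorem IsIndecomposable.isom_of_retract {a : P₁ →ₗ[Λ] P₀} {b : Q₁ →ₗ[Λ] Q₀}
    (hb : IsIndecomposable b) (ha : Nontrivial P₁ ∨ Nontrivial P₀) (h : Retract a b) :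
    Isom a b := by
  obtain ⟨i₁, i₀, p₁, p₀, h1, h2, h3, h4⟩ := h
  have hrange : (LinearMap.range i₁).map b ≤ LinearMap.range i₀ := by
    rintro _ ⟨_, ⟨v, rfl⟩, rfl⟩
    exact ⟨a v, (h1 v).symm⟩
  have hker : (LinearMap.ker p₁).map b ≤ LinearMap.ker p₀ := by
    rintro _ ⟨v, hv, rfl⟩
    have hv' : p₁ v = 0 := hv
    rw [LinearMap.mem_ker, ← h2, hv', map_zero]
  rcases hb.2 _ _ _ _ (isCompl_range_ker h3) (isCompl_range_ker h4) hrange hker with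
    ⟨hr₁, hr₀⟩ | ⟨hk₁, hk₀⟩
  · exfalso
    rw [LinearMap.range_eq_bot] at hr₁ hr₀
    subst hr₁ hr₀
    rcases ha with ha | ha
    · obtain ⟨v, hv⟩ := exists_ne (0 : P₁)
      exact hv (by simpa using (h3 v).symm)
    · obtain ⟨v, hv⟩ := exists_ne (0 : P₀)
      exact hv (by simpa using (h4 v).symm)
  · refine Isom.symm ⟨LinearEquiv.ofBijective p₁ ⟨LinearMap.ker_eq_bot.mp hk₁,
      fun v => ⟨_, h3 v⟩⟩, LinearEquiv.ofBijective p₀ ⟨LinearMap.ker_eq_bot.mp hk₀,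
      fun v => ⟨_, h4 v⟩⟩, h2⟩

end Complexes

/-! ### Generic vanishing of extensions and generic splitting. -/

section GenericComplexes

variable {k : Type*} [Field k]

theorem IsPolyMap.linear_comp {U V W : Type*} [AddCommGroup U] [Module k U] [AddCommGroup V]
    [Module k V] [AddCommGroup W] [Module k W] (L : V →ₗ[k] W) {f : U → V}
    (hf : IsPolyMap (k := k) f) : IsPolyMap (k := k) fun u => L (f u) := fun φ => hf (φ ∘ₗ L)

theorem isPolyMap_id {V : Type*} [AddCommGroup V] [Module k V] :
    IsPolyMap (k := k) fun v : V => v := isPolyMap_linear LinearMap.id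

theorem isPolyMap_fst {V W : Type*} [AddCommGroup V] [Module k V] [AddCommGroup W] [Module k W] :
    IsPolyMap (k := k) (Prod.fst : V × W → V) := isPolyMap_linear (LinearMap.fst k V W)

theorem isPolyMap_snd {V W : Type*} [AddCommGroup V] [Module k V] [AddCommGroup W] [Module k W] :
    IsPolyMap (k := k) (Prod.snd : V × W → W) := isPolyMap_linear (LinearMap.snd k V W)

theorem IsPolyMap.fst {U V W : Type*} [AddCommGroup U] [Module k U] [AddCommGroup V]
    [Module k V] [AddCommGroup W] [Module k W] {f : U → V × W} (hf : IsPolyMap (k := k) f) :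
    IsPolyMap (k := k) fun u => (f u).1 := hf.linear_comp (LinearMap.fst k V W)

theorem IsPolyMap.snd {U V W : Type*} [AddCommGroup U] [Module k U] [AddCommGroup V]
    [Module k V] [AddCommGroup W] [Module k W] {f : U → V × W} (hf : IsPolyMap (k := k) f) :
    IsPolyMap (k := k) fun u => (f u).2 := hf.linear_comp (LinearMap.snd k V W)

theorem tendsto_gen_fst [Infinite k] {V W : Type*} [AddCommGroup V] [Module k V] [AddCommGroup W]
    [Module k W] : Tendsto Prod.fst (gen k (V × W)) (gen k V) :=
  tendsto_gen isPolyMap_fst Prod.fst_surjective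

theorem tendsto_gen_snd [Infinite k] {V W : Type*} [AddCommGroup V] [Module k V] [AddCommGroup W]
    [Module k W] : Tendsto Prod.snd (gen k (V × W)) (gen k W) :=
  tendsto_gen isPolyMap_snd Prod.snd_surjective

variable {Λ : Type*} [Ring Λ] [Algebra k Λ]

instance moduleFinite_linearMap {P₁ P₀ : Type*}
    [AddCommGroup P₁] [Module Λ P₁] [AddCommGroup P₀] [Module Λ P₀]
    [Module k P₁] [IsScalarTower k Λ P₁] [Module.Finite k P₁]
    [Module k P₀] [IsScalarTower k Λ P₀] [Module.Finite k P₀] : Module.Finite k (P₁ →ₗ[Λ] P₀) :=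
  Module.Finite.of_injective (LinearMap.restrictScalarsₗ k Λ P₁ P₀ k)
    (LinearMap.restrictScalars_injective k)

/-- Finite-dimensionality is essential: `finrank` would also be 0 on an infinite-dimensional
quotient. -/
theorem eInv_eq_zero_iff {P₁ P₀ Q₁ Q₀ : Type*}
    [AddCommGroup P₁] [Module Λ P₁] [AddCommGroup P₀] [Module Λ P₀]
    [AddCommGroup Q₁] [Module Λ Q₁] [AddCommGroup Q₀] [Module Λ Q₀]
    [Module k P₁] [IsScalarTower k Λ P₁] [Module.Finite k P₁]
    [Module k Q₁] [IsScalarTower k Λ Q₁]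
    [Module k Q₀] [IsScalarTower k Λ Q₀] [Module.Finite k Q₀] {a : P₁ →ₗ[Λ] P₀} {b : Q₁ →ₗ[Λ] Q₀} :
    eInv k a b = 0 ↔ ExtVanish a b := by
  rw [eInv, Module.finrank_zero_iff, Submodule.Quotient.subsingleton_iff, eq_top_iff]
  constructor
  · intro h f
    obtain ⟨s, r, hf⟩ := h (show f ∈ ⊤ from trivial)
    exact ⟨s, r, fun v => by rw [hf]; rfl⟩
  · intro h f _
    obtain ⟨s, r, hf⟩ := h f
    exact ⟨s, r, LinearMap.ext hf⟩

variable {P₁ P₀ Q₁ Q₀ : Type*}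
  [AddCommGroup P₁] [Module Λ P₁] [AddCommGroup P₀] [Module Λ P₀]
  [AddCommGroup Q₁] [Module Λ Q₁] [AddCommGroup Q₀] [Module Λ Q₀]
  [Module k P₁] [IsScalarTower k Λ P₁] [Module.Finite k P₁]
  [Module k P₀] [IsScalarTower k Λ P₀] [Module.Finite k P₀]
  [Module k Q₁] [IsScalarTower k Λ Q₁] [Module.Finite k Q₁]
  [Module k Q₀] [IsScalarTower k Λ Q₀] [Module.Finite k Q₀]

variable (k Λ P₁ P₀ Q₀) in
/-- Composition of `Λ`-linear maps as a `k`-bilinear map. -/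
def compBilin : (P₀ →ₗ[Λ] Q₀) →ₗ[k] (P₁ →ₗ[Λ] P₀) →ₗ[k] P₁ →ₗ[Λ] Q₀ :=
  LinearMap.mk₂ k (fun s a => s ∘ₗ a) (fun _ _ _ => LinearMap.add_comp _ _ _)
    (fun _ _ _ => LinearMap.smul_comp _ _ _) (fun _ _ _ => LinearMap.comp_add _ _ _)
    (fun _ _ _ => LinearMap.comp_smul _ _ _)

/-- Vanishing is surjectivity of (s, r) ↦ s ∘ a + b ∘ r, a linear map depending linearly on (a, b),
hence an open condition. -/
theorem eventually_extVanish [Infinite k] {V : Type*} [AddCommGroup V] [Module k V]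
    {a : V → P₁ →ₗ[Λ] P₀} {b : V → Q₁ →ₗ[Λ] Q₀} (ha : IsPolyMap (k := k) a)
    (hb : IsPolyMap (k := k) b) {v : V} (hv : ExtVanish (a v) (b v)) :
    ∀ᶠ u in gen k V, ExtVanish (a u) (b u) := by
  let L : (P₁ →ₗ[Λ] P₀) →ₗ[k] ((P₀ →ₗ[Λ] Q₀) × (P₁ →ₗ[Λ] Q₁)) →ₗ[k] P₁ →ₗ[Λ] Q₀ :=
    LinearMap.lcomp k _ (LinearMap.fst k (P₀ →ₗ[Λ] Q₀) (P₁ →ₗ[Λ] Q₁)) ∘ₗ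
      (compBilin k Λ P₁ P₀ Q₀).flip
  let R : (Q₁ →ₗ[Λ] Q₀) →ₗ[k] ((P₀ →ₗ[Λ] Q₀) × (P₁ →ₗ[Λ] Q₁)) →ₗ[k] P₁ →ₗ[Λ] Q₀ :=
    LinearMap.lcomp k _ (LinearMap.snd k (P₀ →ₗ[Λ] Q₀) (P₁ →ₗ[Λ] Q₁)) ∘ₗ compBilin k Λ P₁ Q₁ Q₀
  have key : ∀ u, Function.Surjective (L (a u) + R (b u)) ↔ ExtVanish (a u) (b u) := by
    intro u
    constructor
    · intro h f
      obtain ⟨⟨s, r⟩, hf⟩ := h f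
      exact ⟨s, r, fun v => by rw [← hf]; rfl⟩
    · intro h f
      obtain ⟨s, r, hf⟩ := h f
      exact ⟨(s, r), LinearMap.ext fun v => (hf v).symm⟩
  simp only [← key] at hv ⊢
  exact eventually_surjective ((ha.linear_comp L).add (hb.linear_comp R)) hv

theorem eventually_bijective [Infinite k] :
    ∀ᶠ u : P₁ →ₗ[Λ] P₁ in gen k (P₁ →ₗ[Λ] P₁), Function.Bijective u := by
  have hpoly : IsPolyMap (k := k) fun u : P₁ →ₗ[Λ] P₁ => LinearMap.restrictScalarsₗ k Λ P₁ P₁ k u :=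
    isPolyMap_linear _
  refine (eventually_gen_of_ne_zero hpoly.det_mem (v := LinearMap.id) ?_).mono fun u hu => ?_
  · have : LinearMap.restrictScalarsₗ k Λ P₁ P₁ k LinearMap.id = LinearMap.id := rfl
    simp [this]
  · exact (LinearMap.equivOfDetNeZero _ hu).bijective

/-- If the generic extensions between two families of complexes vanish in both directions, then
a general complex on the sum of the underlying modules is a direct sum of general complexes. -/
theorem eventually_isom_prodMap [IsAlgClosed k] {a₀ : P₁ →ₗ[Λ] P₀} {b₀ : Q₁ →ₗ[Λ] Q₀}
    (hab : ExtVanish a₀ b₀) (hba : ExtVanish b₀ a₀)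
    {p : (P₁ →ₗ[Λ] P₀) → (Q₁ →ₗ[Λ] Q₀) → Prop}
    (hp : ∀ᶠ c in gen k ((P₁ →ₗ[Λ] P₀) × (Q₁ →ₗ[Λ] Q₀)), p c.1 c.2) :
    ∀ᶠ x in gen k (P₁ × Q₁ →ₗ[Λ] P₀ × Q₀), ∃ a b, p a b ∧ Isom x (a.prodMap b) := by
  let V := ((P₀ × Q₀ →ₗ[Λ] P₀ × Q₀) × (P₁ × Q₁ →ₗ[Λ] P₁ × Q₁)) ×
    ((P₁ →ₗ[Λ] P₀) × (Q₁ →ₗ[Λ] Q₀))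
  let φ : V → (P₁ × Q₁ →ₗ[Λ] P₀ × Q₀) := fun v => v.1.1 ∘ₗ (v.2.1.prodMap v.2.2 ∘ₗ v.1.2)
  have hφ : IsPolyMap (k := k) φ := by
    have h11 : IsPolyMap (k := k) fun v : V => v.1.1 :=
      isPolyMap_fst.fst
    have h12 : IsPolyMap (k := k) fun v : V => v.1.2 :=
      isPolyMap_fst.snd
    have h2 : IsPolyMap (k := k) fun v : V => v.2.1.prodMap v.2.2 :=
      isPolyMap_snd.linear_comp (LinearMap.prodMapLinear Λ P₁ Q₁ P₀ Q₀ k)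
    exact IsPolyMap.bilin (compBilin k Λ _ _ _) h11 (IsPolyMap.bilin (compBilin k Λ _ _ _) h2 h12)
  -- The differential sends (S, R, c) to S x + x R + c with x = a₀ ⊕ b₀. The diagonal blocks of w
  -- are absorbed by c, the off-diagonal ones by S and R through `hab` and `hba`; y and z collect
  -- the t² and t³ terms of (1 + tS)(x + tc)(1 + tR).
  have htan : ∀ w, ∃ v y z, ∀ t : k,
      φ (((1, 1), (a₀, b₀)) + t • v) = φ ((1, 1), (a₀, b₀)) + t • (w + t • (y + t • z)) := by
    intro w
    obtain ⟨s, r, hsr⟩ := hab (.snd Λ _ _ ∘ₗ w ∘ₗ .inl Λ _ _)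
    obtain ⟨s', r', hsr'⟩ := hba (.fst Λ _ _ ∘ₗ w ∘ₗ .inr Λ _ _)
    let S : P₀ × Q₀ →ₗ[Λ] P₀ × Q₀ := (s' ∘ₗ .snd Λ _ _).prod (s ∘ₗ .fst Λ _ _)
    let R : P₁ × Q₁ →ₗ[Λ] P₁ × Q₁ := (r' ∘ₗ .snd Λ _ _).prod (r ∘ₗ .fst Λ _ _)
    let a : P₁ →ₗ[Λ] P₀ := .fst Λ _ _ ∘ₗ w ∘ₗ .inl Λ _ _
    let b : Q₁ →ₗ[Λ] Q₀ := .snd Λ _ _ ∘ₗ w ∘ₗ .inr Λ _ _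
    let x := a₀.prodMap b₀
    let c := a.prodMap b
    have hw : w = S ∘ₗ x + x ∘ₗ R + c := by
      refine LinearMap.ext fun v => ?_
      have hv : w v = w (v.1, 0) + w (0, v.2) := by rw [← map_add]; simp
      have e1 := hsr v.1
      have e2 := hsr' v.2
      simp only [LinearMap.comp_apply, LinearMap.inl_apply, LinearMap.inr_apply,
        LinearMap.fst_apply, LinearMap.snd_apply] at e1 e2
      rw [hv]
      ext
      · simp [S, R, x, c, a, e2]
        abel
      · simp [S, R, x, c, b, e1]
    refine ⟨((S, R), (a, b)), S ∘ₗ c + c ∘ₗ R + S ∘ₗ x ∘ₗ R, S ∘ₗ c ∘ₗ R, fun t => ?_⟩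
    have e3 : ∀ t : k, (a₀ + t • a).prodMap (b₀ + t • b) = x + t • c := fun t => rfl
    change (1 + t • S) ∘ₗ ((a₀ + t • a).prodMap (b₀ + t • b) ∘ₗ (1 + t • R)) =
      (1 : _ →ₗ[Λ] _) ∘ₗ (x ∘ₗ (1 : _ →ₗ[Λ] _)) + _
    rw [e3, hw]
    simp only [LinearMap.add_comp, LinearMap.comp_add, LinearMap.smul_comp, LinearMap.comp_smul,
      smul_add, smul_smul, Module.End.one_eq_id, LinearMap.id_comp, LinearMap.comp_id]
    module
  have hle := gen_le_map hφ fun F hF w hw => exists_comp_ne_zero_of_tangent _ htan hF hw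
  -- The parameters are arbitrary endomorphisms, but general ones are invertible, so the image
  -- consists generically of complexes isomorphic to direct sums.
  have hev : ∀ᶠ v in gen k V, Function.Bijective v.1.1 ∧ Function.Bijective v.1.2 ∧
      p v.2.1 v.2.2 := by
    have t11 := tendsto_gen_fst.comp (tendsto_gen_fst : Tendsto Prod.fst (gen k V) _)
    have t12 := tendsto_gen_snd.comp (tendsto_gen_fst : Tendsto Prod.fst (gen k V) _)
    exact (t11.eventually eventually_bijective).and
      ((t12.eventually eventually_bijective).and (tendsto_gen_snd.eventually hp))
  refine hle (eventually_map.mpr (hev.mono ?_))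
  rintro ⟨⟨u, w⟩, a, b⟩ ⟨hu, hw, hab⟩
  refine ⟨a, b, hab, Isom.symm ⟨(LinearEquiv.ofBijective w hw).symm,
    LinearEquiv.ofBijective u hu, fun v => ?_⟩⟩
  change u (a.prodMap b (w ((LinearEquiv.ofBijective w hw).symm v))) = u (a.prodMap b v)
  rw [show w ((LinearEquiv.ofBijective w hw).symm v) = v from
    (LinearEquiv.ofBijective w hw).apply_symm_apply v]

end GenericComplexes

/-! ### The exchange property of indecomposable modules. -/

section Exchange

variable {Λ : Type*} [Ring Λ] {Q X A B M : Type*}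
  [AddCommGroup Q] [Module Λ Q] [AddCommGroup X] [Module Λ X] [AddCommGroup A] [Module Λ A]
  [AddCommGroup B] [Module Λ B] [AddCommGroup M] [Module Λ M]

/-- A module is indecomposable if it is so as a complex concentrated in degree `0`. -/
abbrev IsIndecomposableModule (Λ Q : Type*) [Ring Λ] [AddCommGroup Q] [Module Λ Q] : Prop :=
  IsIndecomposable (0 : PUnit.{1} →ₗ[Λ] Q)

theorem IsIndecomposableModule.nontrivial (hQ : IsIndecomposableModule Λ Q) : Nontrivial Q :=
  hQ.1.resolve_left (not_nontrivial PUnit)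

theorem IsIndecomposableModule.bijective_or [IsNoetherian Λ Q] [IsArtinian Λ Q]
    (hQ : IsIndecomposableModule Λ Q) {φ ψ : Module.End Λ Q} (h : φ + ψ = 1) :
    Function.Bijective φ ∨ Function.Bijective ψ := by
  have := IsIndecomposable.bijective_or hQ (φ₁ := 0) (ψ₁ := 1) (φ₀ := φ) (ψ₀ := ψ) (by simp)
    (by simp) h
  exact this.imp And.right And.right

/-- A split monomorphism decomposes its target. -/
def splitEquiv (i : Q →ₗ[Λ] M) (p : M →ₗ[Λ] Q) (h : ∀ v, p (i v) = v) :
    M ≃ₗ[Λ] Q × LinearMap.ker p :=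
  LinearEquiv.ofLinearMap
    (p.prod ((LinearMap.id - i ∘ₗ p).codRestrict (LinearMap.ker p) fun v => by simp [h]))
    (i.coprod (LinearMap.ker p).subtype)
    (LinearMap.ext fun v => by
      have hv : p v.2.1 = 0 := v.2.2
      ext
      · simp [h, hv]
      · simp [h, hv])
    (LinearMap.ext fun v => by simp)

theorem subsingleton_or_of_equiv_prod (hQ : IsIndecomposableModule Λ Q) (E : Q ≃ₗ[Λ] A × B) :
    Subsingleton A ∨ Subsingleton B := by
  have hcompl : IsCompl (LinearMap.ker (.snd Λ A B ∘ₗ E.toLinearMap))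
      (LinearMap.ker (.fst Λ A B ∘ₗ E.toLinearMap)) := by
    refine ⟨Submodule.disjoint_def.mpr fun v hv hv' => ?_,
      codisjoint_iff.mpr (eq_top_iff.mpr fun v _ => ?_)⟩
    · rw [← E.map_eq_zero_iff]
      exact Prod.ext hv' hv
    · exact Submodule.mem_sup.mpr ⟨E.symm ((E v).1, 0), by simp, E.symm (0, (E v).2), by simp,
        by rw [← map_add]; simp⟩
  rcases hQ.2 ⊤ ⊥ _ _ isCompl_top_bot hcompl (by simp) (by simp) with h | h
  · refine Or.inl (subsingleton_of_forall_eq 0 fun v => ?_)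
    have : E.symm (v, 0) ∈ LinearMap.ker (.snd Λ A B ∘ₗ E.toLinearMap) := by simp
    rw [h.2, Submodule.mem_bot, E.symm.map_eq_zero_iff] at this
    exact congrArg Prod.fst this
  · refine Or.inr (subsingleton_of_forall_eq 0 fun v => ?_)
    have : E.symm (0, v) ∈ LinearMap.ker (.fst Λ A B ∘ₗ E.toLinearMap) := by simp
    rw [h.2, Submodule.mem_bot, E.symm.map_eq_zero_iff] at this
    exact congrArg Prod.snd this

/-- Take A' to be the kernel of the component A → Q, which is split by j. Then X is the kernel of pA
+ pB on A × B, and (a', b) ↦ (a' - j (pB b), b) identifies A' × B with that kernel. -/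
theorem exchange_of_bijective (E : (Q × X) ≃ₗ[Λ] A × B)
    (h : Function.Bijective fun v : Q => (E.symm ((E (v, 0)).1, 0)).1) :
    ∃ A' : Submodule Λ A, Nonempty (A ≃ₗ[Λ] Q × A') ∧ Nonempty (X ≃ₗ[Λ] A' × B) := by
  let pA : A →ₗ[Λ] Q := .fst Λ Q X ∘ₗ E.symm.toLinearMap ∘ₗ .inl Λ A B
  let pB : B →ₗ[Λ] Q := .fst Λ Q X ∘ₗ E.symm.toLinearMap ∘ₗ .inr Λ A B
  let i : Q →ₗ[Λ] A := .fst Λ A B ∘ₗ E.toLinearMap ∘ₗ .inl Λ Q X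
  let u : Q ≃ₗ[Λ] Q := LinearEquiv.ofBijective (pA ∘ₗ i) h
  let j : Q →ₗ[Λ] A := i ∘ₗ u.symm.toLinearMap
  have hj : ∀ v, pA (j v) = v := fun v => u.apply_symm_apply v
  have hp : ∀ y : A × B, (E.symm y).1 = pA y.1 + pB y.2 := by
    intro y
    simp only [pA, pB, LinearMap.comp_apply, ← map_add]
    simp
  let F : X →ₗ[Λ] A := (.fst Λ A B + j ∘ₗ pB ∘ₗ .snd Λ A B) ∘ₗ E.toLinearMap ∘ₗ .inr Λ Q X
  have hF : ∀ x, F x ∈ LinearMap.ker pA := by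
    intro x
    have := hp (E (0, x))
    simp only [LinearEquiv.symm_apply_apply] at this
    simp [F, hj, ← this]
  refine ⟨LinearMap.ker pA, ⟨splitEquiv j pA hj⟩, ⟨LinearEquiv.ofLinearMap
    (LinearMap.prod (F.codRestrict _ hF) (.snd Λ A B ∘ₗ E.toLinearMap ∘ₗ .inr Λ Q X))
    (.snd Λ Q X ∘ₗ E.symm.toLinearMap ∘ₗ
      LinearMap.prod ((LinearMap.ker pA).subtype ∘ₗ .fst Λ _ B - j ∘ₗ pB ∘ₗ .snd Λ _ B)
        (.snd Λ _ B)) ?_ ?_⟩⟩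
  · refine LinearMap.ext fun v => ?_
    have hv : pA v.1.1 = 0 := v.1.2
    have h0 : (E.symm (v.1.1 - j (pB v.2), v.2)).1 = 0 := by rw [hp]; simp [hj, hv]
    have h1 : E (0, (E.symm (v.1.1 - j (pB v.2), v.2)).2) = (v.1.1 - j (pB v.2), v.2) := by
      rw [← h0, Prod.mk.eta, LinearEquiv.apply_symm_apply]
    refine Prod.ext (Subtype.ext ?_) ?_
    · change F (E.symm (v.1.1 - j (pB v.2), v.2)).2 = v.1.1
      simp [F, h1]
    · simp [h1]
  · refine LinearMap.ext fun x => ?_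
    change (E.symm (F x - j (pB (E (0, x)).2), (E (0, x)).2)).2 = x
    simp [F]

/-- The exchange property of indecomposable modules of finite length. -/
theorem IsIndecomposableModule.exchange [IsNoetherian Λ Q] [IsArtinian Λ Q]
    (hQ : IsIndecomposableModule Λ Q) (E : (Q × X) ≃ₗ[Λ] A × B) :
    (∃ A' : Submodule Λ A, Nonempty (A ≃ₗ[Λ] Q × A') ∧ Nonempty (X ≃ₗ[Λ] A' × B)) ∨
      ∃ B' : Submodule Λ B, Nonempty (B ≃ₗ[Λ] Q × B') ∧ Nonempty (X ≃ₗ[Λ] A × B') := by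
  let p : A × B →ₗ[Λ] Q := .fst Λ Q X ∘ₗ E.symm.toLinearMap
  let i : Q →ₗ[Λ] A × B := E.toLinearMap ∘ₗ .inl Λ Q X
  rcases hQ.bijective_or (φ := (p ∘ₗ .inl Λ A B) ∘ₗ (.fst Λ A B ∘ₗ i))
    (ψ := (p ∘ₗ .inr Λ A B) ∘ₗ (.snd Λ A B ∘ₗ i))
    (LinearMap.ext fun v => by simp [← map_add, i, p, ← Prod.fst_add]) with h | h
  · exact Or.inl (exchange_of_bijective E h)
  · obtain ⟨B', h1, ⟨h2⟩⟩ := exchange_of_bijective (E.trans (LinearEquiv.prodComm Λ A B)) h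
    exact Or.inr ⟨B', h1, ⟨h2.trans (LinearEquiv.prodComm Λ B' A)⟩⟩

end Exchange

/-! ### Krull–Schmidt for the projectives P^m. -/

section Projectives

variable {Λ : Type*} [Ring Λ] {n : ℕ} {e : Fin n → Λ}

/-- A decomposition A ⊕ B of Λe_i splits e_i = a + b into orthogonal idempotents; primitivity kills
a or b, and with it the summand it generates. -/
theorem isIndecomposableModule_proj {i : Fin n} (he : IsPrimitiveIdempotent (e i)) :
    IsIndecomposableModule Λ (proj e i) := by
  obtain ⟨hid, hne, hprim⟩ := he
  let ε : proj e i := ⟨e i, Submodule.mem_span_singleton_self _⟩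
  have hε : ∀ v : proj e i, v.1 • ε = v := by
    intro v
    obtain ⟨c, hc⟩ := Submodule.mem_span_singleton.mp v.2
    refine Subtype.ext ?_
    change v.1 * e i = v.1
    rw [← hc, smul_eq_mul, mul_assoc, hid]
  refine ⟨Or.inr ⟨ε, 0, fun h => hne (congrArg Subtype.val h)⟩, ?_⟩
  intro A₁ B₁ A B _ hAB _ _
  obtain ⟨a, ha, b, hb, hab⟩ := Submodule.mem_sup.mp
    (show ε ∈ A ⊔ B by rw [hAB.sup_eq_top]; trivial)
  have hdis := Submodule.disjoint_def.mp hAB.disjoint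
  have key : ∀ v : proj e i, v = v.1 • a + v.1 • b := fun v => by rw [← smul_add, hab, hε]
  have hA : ∀ v ∈ A, v.1 • b = 0 ∧ v.1 • a = v := by
    intro v hv
    have h0 : v.1 • b = 0 := by
      refine hdis _ ?_ (B.smul_mem _ hb)
      have : v.1 • b = v - v.1 • a := by rw [eq_sub_iff_add_eq', ← key]
      rw [this]
      exact A.sub_mem hv (A.smul_mem _ ha)
    refine ⟨h0, ?_⟩
    have := key v
    rw [h0, add_zero] at this
    exact this.symm
  have hB : ∀ v ∈ B, v.1 • a = 0 ∧ v.1 • b = v := by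
    intro v hv
    have h0 : v.1 • a = 0 := by
      refine hdis _ (A.smul_mem _ ha) ?_
      have : v.1 • a = v - v.1 • b := by rw [eq_sub_iff_add_eq, ← key]
      rw [this]
      exact B.sub_mem hv (B.smul_mem _ hb)
    refine ⟨h0, ?_⟩
    have := key v
    rw [h0, zero_add] at this
    exact this.symm
  have hsub : ∀ C : Submodule Λ PUnit.{1}, C = ⊥ := fun C => Subsingleton.elim _ _
  rcases hprim a.1 b.1 (congrArg Subtype.val (hA a ha).2) (congrArg Subtype.val (hB b hb).2)
    (congrArg Subtype.val (hA a ha).1) (congrArg Subtype.val (hB b hb).1)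
    (congrArg Subtype.val hab).symm with h | h
  · refine Or.inl ⟨hsub _, (Submodule.eq_bot_iff _).mpr fun v hv => ?_⟩
    rw [← (hA v hv).2, show a = 0 from Subtype.ext h, smul_zero]
  · refine Or.inr ⟨hsub _, (Submodule.eq_bot_iff _).mpr fun v hv => ?_⟩
    rw [← (hB v hv).2, show b = 0 from Subtype.ext h, smul_zero]

variable (e) in
/-- `P^{m + m'} ≅ P^m ⊕ P^{m'}`. -/
def projSumAdd (m m' : Fin n → ℕ) :
    projSum e (m + m') ≃ₗ[Λ] projSum e m × projSum e m' where
  toFun f := (fun i t => f i (Fin.castAdd _ t), fun i t => f i (Fin.natAdd _ t))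
  invFun f := fun i => Fin.append (f.1 i) (f.2 i)
  map_add' _ _ := rfl
  map_smul' _ _ := rfl
  left_inv f := funext fun i => Fin.append_castAdd_natAdd
  right_inv f := by
    ext i t
    · simp
    · simp

variable (e) in
/-- The projective `P_i` as a direct sum with a single summand. -/
def projSumSingle (i : Fin n) : projSum e (Pi.single i 1) ≃ₗ[Λ] proj e i where
  toFun f := f i ⟨0, by simp⟩
  invFun v := Pi.single i fun _ => v
  map_add' _ _ := rfl
  map_smul' _ _ := rfl
  left_inv f := by
    funext j t
    by_cases h : j = i
    · subst h
      have : t = ⟨0, by simp⟩ := by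
        have := t.2
        simp only [Pi.single_eq_same] at this
        exact Fin.ext (by lia)
      subst this
      exact congrFun (Pi.single_eq_same
        (M := fun i => Fin ((Pi.single j 1 : Fin n → ℕ) i) → proj e i) j _) _
    · have := t.2
      simp [h] at this
  right_inv v := by simp

variable (e) in
/-- `P^{e_i + m} ≅ P_i ⊕ P^m`. -/
def projSumCons (i : Fin n) (m : Fin n → ℕ) :
    projSum e (Pi.single i 1 + m) ≃ₗ[Λ] proj e i × projSum e m :=
  (projSumAdd e _ m).trans ((projSumSingle e i).prodCongr (LinearEquiv.refl Λ _))

/-- Equal multiplicities give isomorphic projectives. -/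
def projSumCongr {m m' : Fin n → ℕ} (h : m = m') : projSum e m ≃ₗ[Λ] projSum e m' :=
  h ▸ LinearEquiv.refl Λ _

theorem subsingleton_projSum_zero : Subsingleton (projSum e 0) :=
  ⟨fun _ _ => funext fun _ => funext fun t => t.elim0⟩

theorem exists_eq_single_add {m : Fin n → ℕ} {i : Fin n} (h : 0 < m i) :
    ∃ m' : Fin n → ℕ, m = Pi.single i 1 + m' := by
  refine ⟨m - Pi.single i 1, funext fun j => ?_⟩
  by_cases hj : j = i
  · subst hj
    simp
    lia
  · simp [hj]

theorem multiplicity_induction {motive : (Fin n → ℕ) → Prop} (zero : motive 0)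
    (step : ∀ i m, motive m → motive (Pi.single i 1 + m)) (m : Fin n → ℕ) : motive m := by
  induction hN : ∑ i, m i generalizing m with
  | zero =>
    have : m = 0 := funext fun i => Finset.sum_eq_zero_iff.mp hN i (Finset.mem_univ i)
    exact this ▸ zero
  | succ N ih =>
    obtain ⟨i, -, hi⟩ : ∃ i ∈ Finset.univ, m i ≠ 0 := by
      by_contra! h
      simp [Finset.sum_eq_zero h] at hN
    obtain ⟨m', rfl⟩ := exists_eq_single_add (Nat.pos_of_ne_zero hi)
    refine step i m' (ih m' ?_)
    simp [Finset.sum_add_distrib] at hN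
    lia

variable [IsNoetherianRing Λ] [IsArtinianRing Λ]

/-- Direct summands of `P^m` are of the form `P^{m'}`. -/
theorem exists_projSum_equiv (he : IsBasicSystem e) (m : Fin n → ℕ) {A B : Type*}
    [AddCommGroup A] [Module Λ A] [AddCommGroup B] [Module Λ B] (E : projSum e m ≃ₗ[Λ] A × B) :
    ∃ m' m'' : Fin n → ℕ, m = m' + m'' ∧ Nonempty (A ≃ₗ[Λ] projSum e m') ∧
      Nonempty (B ≃ₗ[Λ] projSum e m'') := by
  induction m using multiplicity_induction generalizing A B with
  | zero =>
    have := subsingleton_projSum_zero (e := e)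
    have : Subsingleton (A × B) := E.symm.injective.subsingleton
    have hA : Subsingleton A := (LinearMap.inl_injective (R := Λ) (M₂ := B)).subsingleton
    have hB : Subsingleton B := (LinearMap.inr_injective (R := Λ) (M := A)).subsingleton
    exact ⟨0, 0, by simp, ⟨LinearEquiv.ofSubsingleton _ _⟩, ⟨LinearEquiv.ofSubsingleton _ _⟩⟩
  | step i m ih =>
    rcases (isIndecomposableModule_proj (he.primitive i)).exchange
      ((projSumCons e i m).symm.trans E) with ⟨A', ⟨h1⟩, ⟨h2⟩⟩ | ⟨B', ⟨h1⟩, ⟨h2⟩⟩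
    · obtain ⟨m', m'', rfl, ⟨h3⟩, h4⟩ := ih h2
      exact ⟨Pi.single i 1 + m', m'', by rw [add_assoc], ⟨h1.trans
        (((LinearEquiv.refl Λ _).prodCongr h3).trans (projSumCons e i m').symm)⟩, h4⟩
    · obtain ⟨m', m'', rfl, h3, ⟨h4⟩⟩ := ih h2
      exact ⟨m', Pi.single i 1 + m'', by rw [add_left_comm], h3, ⟨h1.trans
        (((LinearEquiv.refl Λ _).prodCongr h4).trans (projSumCons e i m'').symm)⟩⟩

/-- The summand P_i is itself some P^{m'}; indecomposability leaves a single P_j there, and j = i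
because the algebra is basic. -/
theorem pos_of_proj_summand (he : IsBasicSystem e) {m : Fin n → ℕ} {i : Fin n} {X : Type*}
    [AddCommGroup X] [Module Λ X] (E : projSum e m ≃ₗ[Λ] proj e i × X) : 0 < m i := by
  have hi := isIndecomposableModule_proj (he.primitive i)
  obtain ⟨m', m'', rfl, ⟨h⟩, -⟩ := exists_projSum_equiv he m E
  obtain ⟨j, hj⟩ : ∃ j, 0 < m' j := by
    by_contra! h0
    have h0' : m' = 0 := funext fun j => Nat.le_zero.mp (h0 j)
    subst h0'
    have := subsingleton_projSum_zero (e := e)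
    exact not_subsingleton_iff_nontrivial.mpr hi.nontrivial h.injective.subsingleton
  obtain ⟨m₀, rfl⟩ := exists_eq_single_add hj
  rcases subsingleton_or_of_equiv_prod hi (h.trans (projSumCons e j m₀)) with hs | hs
  · exact absurd hs (not_subsingleton_iff_nontrivial.mpr
      (isIndecomposableModule_proj (he.primitive j)).nontrivial)
  · have := Unique.mk' (projSum e m₀)
    have : i = j := he.basic i j ⟨(h.trans (projSumCons e j m₀)).trans LinearEquiv.prodUnique⟩
    subst this
    simp

/-- The multiplicities are determined by the module `P^m`. -/
theorem eq_of_projSum_equiv (he : IsBasicSystem e) {m m' : Fin n → ℕ}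
    (E : projSum e m ≃ₗ[Λ] projSum e m') : m = m' := by
  induction m using multiplicity_induction generalizing m' with
  | zero =>
    by_contra h
    obtain ⟨i, hi⟩ : ∃ i, 0 < m' i := by
      by_contra! h0
      exact h (funext fun j => (Nat.le_zero.mp (h0 j)).symm)
    obtain ⟨m₀, rfl⟩ := exists_eq_single_add hi
    have := pos_of_proj_summand he (E.trans (projSumCons e i m₀))
    simp at this
  | step i m ih =>
    have hi := isIndecomposableModule_proj (he.primitive i)
    obtain ⟨m₀, rfl⟩ := exists_eq_single_add
      (pos_of_proj_summand he (E.symm.trans (projSumCons e i m)))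
    suffices h : Nonempty (projSum e m ≃ₗ[Λ] projSum e m₀) by
      rw [ih h.some]
    -- Cancellation of P_i: either its complement A' in P_i is zero, or both remaining modules are
    -- P_i × B'.
    rcases hi.exchange ((projSumCons e i m).symm.trans (E.trans (projSumCons e i m₀))) with
      ⟨A', ⟨h1⟩, ⟨h2⟩⟩ | ⟨B', ⟨h1⟩, ⟨h2⟩⟩
    · rcases subsingleton_or_of_equiv_prod hi h1 with hs | hs
      · exact absurd hs (not_subsingleton_iff_nontrivial.mpr hi.nontrivial)
      · have := Unique.mk' A'
        exact ⟨h2.trans LinearEquiv.uniqueProd⟩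
    · exact ⟨h2.trans h1.symm⟩

end Projectives

/-! ### Sign-coherence of g-vectors. -/

section Coherent

variable {n : ℕ}

/-- No coordinate has opposite signs in the two vectors. -/
def Coherent (g h : Fin n → ℤ) : Prop := ∀ i, ¬(g i < 0 ∧ 0 < h i) ∧ ¬(0 < g i ∧ h i < 0)

theorem Coherent.symm {g h : Fin n → ℤ} (hc : Coherent g h) : Coherent h g :=
  fun i => by have := hc i; lia

theorem Coherent.refl (g : Fin n → ℤ) : Coherent g g := fun i => by lia

theorem Coherent.closure_right {g : Fin n → ℤ} {T : Set (Fin n → ℤ)}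
    (hc : ∀ h ∈ T, Coherent g h) {h : Fin n → ℤ} (hh : h ∈ AddSubmonoid.closure T) :
    Coherent g h := by
  induction hh using AddSubmonoid.closure_induction with
  | mem h hh => exact hc h hh
  | zero => exact fun i => by simp
  | add x y _ _ hx hy =>
    intro i
    have := hx i
    have := hy i
    simp only [Pi.add_apply]
    lia

theorem Coherent.closure {S T : Set (Fin n → ℤ)} (hc : ∀ g ∈ S, ∀ h ∈ T, Coherent g h)
    {g h : Fin n → ℤ} (hg : g ∈ AddSubmonoid.closure S) (hh : h ∈ AddSubmonoid.closure T) :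
    Coherent g h :=
  (Coherent.closure_right (fun g' hg' => (Coherent.closure_right (hc g' hg') hh).symm) hg).symm

theorem nsmul_mem_closure_singleton (t : ℕ) (h : Fin n → ℤ) :
    t • h ∈ AddSubmonoid.closure {h} :=
  nsmul_mem (AddSubmonoid.subset_closure (Set.mem_singleton h)) t

end Coherent

/-! ### Calculus of direct sums and summands of g-vectors. -/

section GVectors

variable {k : Type*} [Field k] {Λ : Type*} [Ring Λ] [Algebra k Λ] {n : ℕ} {e : Fin n → Λ}

theorem IsDirectSum.symm {g h : Fin n → ℤ} (hgh : IsDirectSum k e g h) : IsDirectSum k e h g :=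
  ⟨hgh.2, hgh.1⟩

variable (k Λ) in
theorem isNoetherianRing_of_moduleFinite [Module.Finite k Λ] : IsNoetherianRing Λ :=
  isNoetherian_of_tower k (inferInstanceAs (IsNoetherian k Λ))

variable (k Λ) in
theorem isArtinianRing_of_moduleFinite [Module.Finite k Λ] : IsArtinianRing Λ :=
  isArtinian_of_tower k (inferInstanceAs (IsArtinian k Λ))

variable [Module.Finite k Λ]

instance moduleFinite_submodule (N : Submodule Λ Λ) : Module.Finite k N :=
  inferInstanceAs (Module.Finite k (N.restrictScalars k))

theorem eInvG_eq_zero_iff {g h : Fin n → ℤ} :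
    eInvG k e g h = 0 ↔ ∃ (a : Pres e g) (b : Pres e h), ExtVanish a b := by
  simp only [eInvG, Nat.sInf_eq_zero, Set.mem_ofPred_eq]
  constructor
  · rintro (⟨a, b, hab⟩ | hempty)
    · exact ⟨a, b, eInv_eq_zero_iff.mp hab.symm⟩
    -- The default `sInf ∅ = 0` does not interfere, since the zero maps give an element.
    · exact absurd hempty (Set.Nonempty.ne_empty ⟨_, 0, 0, rfl⟩)
  · rintro ⟨a, b, hab⟩
    exact Or.inl ⟨a, b, (eInv_eq_zero_iff.mpr hab).symm⟩

theorem subsingleton_projSum {m : Fin n → ℕ} (h : m = 0) : Subsingleton (projSum e m) :=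
  h ▸ subsingleton_projSum_zero

theorem eInvG_zero_right (g : Fin n → ℤ) : eInvG k e g 0 = 0 := by
  have : Subsingleton (posProj e 0) := subsingleton_projSum (by ext; simp)
  exact eInvG_eq_zero_iff.mpr ⟨0, 0, fun f => ⟨0, 0, fun v => Subsingleton.elim _ _⟩⟩

theorem eInvG_zero_left (g : Fin n → ℤ) : eInvG k e 0 g = 0 := by
  have : Subsingleton (negProj e 0) := subsingleton_projSum (by ext; simp)
  refine eInvG_eq_zero_iff.mpr ⟨0, 0, fun f => ⟨0, 0, fun v => ?_⟩⟩
  rw [Subsingleton.elim v 0]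
  simp

/-- Otherwise P_i is a summand of P^{g-} and of P^{h+}. A null-homotopy of P^{g-} → P_i → P^{h+}
writes the identity of P_i as a sum of endomorphisms through P^{g+} and P^{h-}. One of them is
bijective, so P_i is a summand of P^{g+} or P^{h-}, against the signs. -/
theorem not_pos_of_eInvG (he : IsBasicSystem e) {g h : Fin n → ℤ} (hgh : eInvG k e g h = 0)
    (i : Fin n) : ¬(g i < 0 ∧ 0 < h i) := by
  rintro ⟨hg, hh⟩
  have := isNoetherianRing_of_moduleFinite k Λ
  have := isArtinianRing_of_moduleFinite k Λ
  have hi := isIndecomposableModule_proj (he.primitive i)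
  obtain ⟨a, b, hab⟩ := eInvG_eq_zero_iff.mp hgh
  have split : ∀ m : Fin n → ℕ, 0 < m i → ∃ (ι : proj e i →ₗ[Λ] projSum e m)
      (π : projSum e m →ₗ[Λ] proj e i), ∀ v, π (ι v) = v := by
    intro m hm
    obtain ⟨m', rfl⟩ := exists_eq_single_add hm
    exact ⟨(projSumCons e i m').symm.toLinearMap ∘ₗ .inl Λ _ _,
      .fst Λ _ _ ∘ₗ (projSumCons e i m').toLinearMap, by simp⟩
  have pos : ∀ (m : Fin n → ℕ) (ι : proj e i →ₗ[Λ] projSum e m)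
      (π : projSum e m →ₗ[Λ] proj e i), Function.Bijective (π ∘ₗ ι) → 0 < m i := by
    intro m ι π hb
    let u := LinearEquiv.ofBijective _ hb
    exact pos_of_proj_summand he (splitEquiv ι (u.symm.toLinearMap ∘ₗ π) fun v =>
      u.symm_apply_apply v)
  obtain ⟨ι, π, h1⟩ := split (fun i => (-g i).toNat) (by lia)
  obtain ⟨ι', π', h2⟩ := split (fun i => (h i).toNat) (by lia)
  obtain ⟨s, r, hsr⟩ := hab (ι' ∘ₗ π)
  have key : ((π' ∘ₗ s) ∘ₗ (a ∘ₗ ι) : Module.End Λ (proj e i)) + (π' ∘ₗ b) ∘ₗ (r ∘ₗ ι) = 1 := by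
    refine LinearMap.ext fun v => ?_
    have := congrArg π' (hsr (ι v))
    simpa [h1, h2] using this.symm
  rcases hi.bijective_or key with hb | hb
  · have := pos _ _ _ hb
    lia
  · have := pos _ _ _ hb
    lia

theorem IsDirectSum.coherent (he : IsBasicSystem e) {g h : Fin n → ℤ}
    (hgh : IsDirectSum k e g h) : Coherent g h := fun i =>
  ⟨not_pos_of_eInvG he hgh.1 i, fun h' => not_pos_of_eInvG he hgh.2 i h'.symm⟩

variable [IsAlgClosed k]

theorem eventually_extVanish_left {g h : Fin n → ℤ} {a : Pres e g} {b : Pres e h}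
    (hab : ExtVanish a b) : ∀ᶠ a in gen k (Pres e g), ExtVanish a b :=
  eventually_extVanish isPolyMap_id (isPolyMap_const b) hab

theorem eventually_extVanish_right {g h : Fin n → ℤ} {a : Pres e g} {b : Pres e h}
    (hab : ExtVanish a b) : ∀ᶠ b in gen k (Pres e h), ExtVanish a b :=
  eventually_extVanish (isPolyMap_const a) isPolyMap_id hab

theorem eventually_extVanish_prod {g h : Fin n → ℤ} (hgh : eInvG k e g h = 0) :
    ∀ᶠ c in gen k (Pres e g × Pres e h), ExtVanish c.1 c.2 := by
  obtain ⟨a, b, hab⟩ := eInvG_eq_zero_iff.mp hgh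
  exact eventually_extVanish isPolyMap_fst isPolyMap_snd (v := (a, b)) hab

variable (e) in
/-- `P^{(g+h)+} ≅ P^{g+} ⊕ P^{h+}` for sign-coherent g-vectors. -/
def posAdd {g h : Fin n → ℤ} (hc : Coherent g h) :
    posProj e (g + h) ≃ₗ[Λ] posProj e g × posProj e h :=
  (projSumCongr (funext fun i => by have := hc i; simp; lia)).trans
    (projSumAdd e (fun i => (g i).toNat) fun i => (h i).toNat)

variable (e) in
/-- `P^{(g+h)-} ≅ P^{g-} ⊕ P^{h-}` for sign-coherent g-vectors. -/
def negAdd {g h : Fin n → ℤ} (hc : Coherent g h) :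
    negProj e (g + h) ≃ₗ[Λ] negProj e g × negProj e h :=
  (projSumCongr (funext fun i => by have := hc i; simp; lia)).trans
    (projSumAdd e (fun i => (-g i).toNat) fun i => (-h i).toNat)

theorem exists_isom_prodMap {g h : Fin n → ℤ} (hc : Coherent g h) (a : Pres e g) (b : Pres e h) :
    ∃ x : Pres e (g + h), Isom x (a.prodMap b) :=
  ⟨(posAdd e hc).symm.toLinearMap ∘ₗ a.prodMap b ∘ₗ (negAdd e hc).toLinearMap,
    negAdd e hc, posAdd e hc, fun v => by simp⟩

/-- One general a serves both h and h'. Coherence is what makes b ⊕ b' an element of Hom(h + h'). -/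
theorem eInvG_add_right {g h h' : Fin n → ℤ} (hc : Coherent h h') (hh : eInvG k e g h = 0)
    (hh' : eInvG k e g h' = 0) : eInvG k e g (h + h') = 0 := by
  obtain ⟨a, b, hab⟩ := eInvG_eq_zero_iff.mp hh
  obtain ⟨a', b', hab'⟩ := eInvG_eq_zero_iff.mp hh'
  obtain ⟨a, h1, h2⟩ := ((eventually_extVanish_left (k := k) hab).and
    (eventually_extVanish_left hab')).exists
  obtain ⟨x, hx⟩ := exists_isom_prodMap hc b b'
  exact eInvG_eq_zero_iff.mpr ⟨a, x, .of_retract_right hx.retract (h1.prod_right h2)⟩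

theorem eInvG_add_left {g h h' : Fin n → ℤ} (hc : Coherent h h') (hh : eInvG k e h g = 0)
    (hh' : eInvG k e h' g = 0) : eInvG k e (h + h') g = 0 := by
  obtain ⟨a, b, hab⟩ := eInvG_eq_zero_iff.mp hh
  obtain ⟨a', b', hab'⟩ := eInvG_eq_zero_iff.mp hh'
  obtain ⟨b, h1, h2⟩ := ((eventually_extVanish_right (k := k) hab).and
    (eventually_extVanish_right hab')).exists
  obtain ⟨x, hx⟩ := exists_isom_prodMap hc a a'
  exact eInvG_eq_zero_iff.mpr ⟨x, b, .of_retract_left hx.retract (h1.prod_left h2)⟩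

theorem eInvG_closure_right {g : Fin n → ℤ} {T : Set (Fin n → ℤ)}
    (hT : ∀ x ∈ T, ∀ y ∈ T, Coherent x y) (hg : ∀ x ∈ T, eInvG k e g x = 0) {h : Fin n → ℤ}
    (hh : h ∈ AddSubmonoid.closure T) : eInvG k e g h = 0 := by
  induction hh using AddSubmonoid.closure_induction with
  | mem h hh => exact hg h hh
  | zero => exact eInvG_zero_right g
  | add x y hx hy hx' hy' => exact eInvG_add_right (Coherent.closure hT hx hy) hx' hy'

theorem eInvG_closure_left {g : Fin n → ℤ} {T : Set (Fin n → ℤ)}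
    (hT : ∀ x ∈ T, ∀ y ∈ T, Coherent x y) (hg : ∀ x ∈ T, eInvG k e x g = 0) {h : Fin n → ℤ}
    (hh : h ∈ AddSubmonoid.closure T) : eInvG k e h g = 0 := by
  induction hh using AddSubmonoid.closure_induction with
  | mem h hh => exact hg h hh
  | zero => exact eInvG_zero_left g
  | add x y hx hy hx' hy' => exact eInvG_add_left (Coherent.closure hT hx hy) hx' hy'

theorem IsDirectSum.closure {S T : Set (Fin n → ℤ)} (hS : ∀ x ∈ S, ∀ y ∈ S, Coherent x y)
    (hT : ∀ x ∈ T, ∀ y ∈ T, Coherent x y) (h : ∀ x ∈ S, ∀ y ∈ T, IsDirectSum k e x y)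
    {x y : Fin n → ℤ} (hx : x ∈ AddSubmonoid.closure S) (hy : y ∈ AddSubmonoid.closure T) :
    IsDirectSum k e x y :=
  ⟨eInvG_closure_left hS (fun s hs => eInvG_closure_right hT (fun t ht => (h s hs t ht).1) hy) hx,
    eInvG_closure_right hS (fun s hs => eInvG_closure_left hT (fun t ht => (h s hs t ht).2) hy) hx⟩

theorem IsDirectSum.closure_right {g : Fin n → ℤ} {T : Set (Fin n → ℤ)}
    (hT : ∀ x ∈ T, ∀ y ∈ T, Coherent x y) (h : ∀ y ∈ T, IsDirectSum k e g y)
    {y : Fin n → ℤ} (hy : y ∈ AddSubmonoid.closure T) : IsDirectSum k e g y :=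
  ⟨eInvG_closure_right hT (fun t ht => (h t ht).1) hy,
    eInvG_closure_left hT (fun t ht => (h t ht).2) hy⟩

theorem IsDirectSum.nsmul_right {g h : Fin n → ℤ} (hgh : IsDirectSum k e g h) (t : ℕ) :
    IsDirectSum k e g (t • h) := by
  refine IsDirectSum.closure_right (T := {h}) ?_ ?_ (nsmul_mem_closure_singleton t h)
  · rintro _ rfl _ rfl
    exact Coherent.refl _
  · rintro _ rfl
    exact hgh

theorem IsDirectSum.add_right {g h h' : Fin n → ℤ} (hc : Coherent h h')
    (hh : IsDirectSum k e g h) (hh' : IsDirectSum k e g h') : IsDirectSum k e g (h + h') :=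
  ⟨eInvG_add_right hc hh.1 hh'.1, eInvG_add_left hc hh.2 hh'.2⟩

/-- A general element of `Hom(g ⊕ h)` is a direct sum of general elements of `Hom(g)`
and `Hom(h)`. -/
theorem IsDirectSum.eventually_isom (he : IsBasicSystem e) {f g h : Fin n → ℤ}
    (hgh : IsDirectSum k e g h) (hf : f = g + h) {p : Pres e g → Pres e h → Prop}
    (hp : ∀ᶠ c in gen k (Pres e g × Pres e h), p c.1 c.2) :
    ∀ᶠ x in gen k (Pres e f), ∃ a b, p a b ∧ Isom x (a.prodMap b) := by
  subst hf
  have hc := hgh.coherent he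
  obtain ⟨a, b, h1, h2⟩ : ∃ (a : Pres e g) (b : Pres e h), ExtVanish a b ∧ ExtVanish b a := by
    obtain ⟨⟨a, b⟩, h1, h2⟩ := ((eventually_extVanish_prod hgh.1).and ((tendsto_gen
      (isPolyMap_linear (LinearEquiv.prodComm k (Pres e g) (Pres e h)).toLinearMap)
      (LinearEquiv.prodComm k (Pres e g) (Pres e h)).surjective).eventually
      (eventually_extVanish_prod hgh.2))).exists
    exact ⟨a, b, h1, h2⟩
  have key := eventually_isom_prodMap h1 h2 hp
  let L : Pres e (g + h) →ₗ[k] (negProj e g × negProj e h →ₗ[Λ] posProj e g × posProj e h) :=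
    (compBilin k Λ _ _ _).flip (negAdd e hc).symm.toLinearMap ∘ₗ
      compBilin k Λ _ _ _ (posAdd e hc).toLinearMap
  have hL : ∀ x v, L x v = posAdd e hc (x ((negAdd e hc).symm v)) := fun _ _ => rfl
  have hsurj : Function.Surjective L := fun y =>
    ⟨(posAdd e hc).symm.toLinearMap ∘ₗ y ∘ₗ (negAdd e hc).toLinearMap,
      LinearMap.ext fun v => by simp [hL]⟩
  refine ((tendsto_gen (isPolyMap_linear L) hsurj).eventually key).mono ?_
  rintro x ⟨a, b, hab, hx⟩
  exact ⟨a, b, hab, Isom.trans ⟨negAdd e hc, posAdd e hc, fun v => by simp [hL]⟩ hx⟩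

/-- A general element of Hom(f) has a retract in Hom(h), and vanishing of extensions passes to
retracts. -/
theorem IsSummand.eInvG_right (he : IsBasicSystem e) {g h f : Fin n → ℤ}
    (hh : IsSummand k e h f) (hg : eInvG k e g f = 0) : eInvG k e g h = 0 := by
  obtain ⟨h', hf, hd⟩ := hh
  obtain ⟨a, x, hax⟩ := eInvG_eq_zero_iff.mp hg
  obtain ⟨x, h1, b, b', -, h2⟩ := ((eventually_extVanish_right (k := k) hax).and
    (hd.eventually_isom he hf (p := fun _ _ => True) (by simp))).exists
  exact eInvG_eq_zero_iff.mpr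
    ⟨a, b, h1.of_retract_right ((retract_prodMap_left b b').trans h2.symm.retract)⟩

theorem IsSummand.eInvG_left (he : IsBasicSystem e) {g h f : Fin n → ℤ}
    (hh : IsSummand k e h f) (hg : eInvG k e f g = 0) : eInvG k e h g = 0 := by
  obtain ⟨h', hf, hd⟩ := hh
  obtain ⟨x, a, hax⟩ := eInvG_eq_zero_iff.mp hg
  obtain ⟨x, h1, b, b', -, h2⟩ := ((eventually_extVanish_left (k := k) hax).and
    (hd.eventually_isom he hf (p := fun _ _ => True) (by simp))).exists
  exact eInvG_eq_zero_iff.mpr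
    ⟨b, a, h1.of_retract_left ((retract_prodMap_left b b').trans h2.symm.retract)⟩

theorem IsSummand.isDirectSum_right (he : IsBasicSystem e) {g h f : Fin n → ℤ}
    (hh : IsSummand k e h f) (hg : IsDirectSum k e g f) : IsDirectSum k e g h :=
  ⟨hh.eInvG_right he hg.1, hh.eInvG_left he hg.2⟩

theorem IsSummand.trans (he : IsBasicSystem e) {x g f : Fin n → ℤ} (hx : IsSummand k e x g)
    (hg : IsSummand k e g f) : IsSummand k e x f := by
  obtain ⟨g', rfl, hgg'⟩ := hg
  have hxg' := (hx.isDirectSum_right he hgg'.symm).symm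
  obtain ⟨r, rfl, hxr⟩ := hx
  have hr : IsSummand k e r (x + r) := ⟨x, add_comm _ _, hxr.symm⟩
  have hrg' := (hr.isDirectSum_right he hgg'.symm).symm
  exact ⟨r + g', add_assoc _ _ _, hxr.add_right (hrg'.coherent he) hxg'⟩

theorem eq_of_isom (he : IsBasicSystem e) [IsNoetherianRing Λ] [IsArtinianRing Λ]
    {g h : Fin n → ℤ} {a : Pres e g} {b : Pres e h} (hab : Isom a b) : g = h := by
  obtain ⟨u₁, u₀, -⟩ := hab
  have h1 := eq_of_projSum_equiv he u₁
  have h0 := eq_of_projSum_equiv he u₀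
  funext i
  have := congrFun h1 i
  have := congrFun h0 i
  lia

/-- Distinct generically indecomposable summands of a g-vector are compatible. -/
theorem isDirectSum_of_mem_ind (he : IsBasicSystem e) {g x y : Fin n → ℤ} (hx : x ∈ ind k e g)
    (hy : y ∈ ind k e g) (hxy : x ≠ y) : IsDirectSum k e x y := by
  have := isNoetherianRing_of_moduleFinite k Λ
  have := isArtinianRing_of_moduleFinite k Λ
  obtain ⟨hxi, x', hgx, hdx⟩ := hx
  obtain ⟨hyi, y', hgy, hdy⟩ := hy
  rw [GenericallyIndecomposable, general_iff] at hxi hyi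
  have hy' : ∀ᶠ c in gen k (Pres e y × Pres e y'),
      IsIndecomposable c.1 ∧ ExtVanish c.1 c.2 ∧ ExtVanish c.2 c.1 :=
    (tendsto_gen_fst.eventually hyi).and ((eventually_extVanish_prod hdy.1).and ((tendsto_gen
      (isPolyMap_linear (LinearEquiv.prodComm k (Pres e y) (Pres e y')).toLinearMap)
      (LinearEquiv.prodComm k (Pres e y) (Pres e y')).surjective).eventually
      (eventually_extVanish_prod hdy.2)))
  obtain ⟨z, ⟨a, c, ha, hac⟩, b, d, ⟨hb, hbd, hdb⟩, hz⟩ :=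
    ((hdx.eventually_isom he hgx (p := fun a _ => IsIndecomposable a)
      (tendsto_gen_fst.eventually hxi)).and (hdy.eventually_isom he hgy
        (p := fun b d => IsIndecomposable b ∧ ExtVanish b d ∧
        ExtVanish d b) hy')).exists
  -- One general z decomposes as a ⊕ c and as b ⊕ d. If the indecomposable a sits in b, then a ≅ b
  -- and x = y; otherwise it sits in d, whose extensions with b vanish both ways.
  rcases ha.retract_or (((retract_prodMap_left a c).trans hac.symm.retract).trans hz.retract) with
    h | h
  · exact absurd (eq_of_isom he (hb.isom_of_retract ha.1 h)) hxy
  · exact ⟨eInvG_eq_zero_iff.mpr ⟨a, b, hdb.of_retract_left h⟩,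
      eInvG_eq_zero_iff.mpr ⟨b, a, hbd.of_retract_right h⟩⟩

/-- In a direct sum of tame generically indecomposable g-vectors, the indecomposable summands
of a general element are accounted for. -/
theorem eventually_mem_of_retract (he : IsBasicSystem e) {J : Set (Fin n → ℤ)}
    (hJ : ∀ x ∈ J, GenericallyIndecomposable k e x) (hd : ∀ x ∈ J, ∀ y ∈ J, IsDirectSum k e x y)
    {f : Fin n → ℤ} (hf : f ∈ AddSubmonoid.closure J) :
    ∀ᶠ z in gen k (Pres e f), ∀ (h : Fin n → ℤ) (a : Pres e h), IsIndecomposable a →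
      Retract a z → h ∈ J := by
  have := isNoetherianRing_of_moduleFinite k Λ
  have := isArtinianRing_of_moduleFinite k Λ
  induction hf using AddSubmonoid.closure_induction_left with
  | zero =>
    refine Eventually.of_forall ?_
    rintro z h a ⟨hne, -⟩ ⟨i₁, i₀, p₁, p₀, -, -, h₁, h₀⟩
    have s1 : Subsingleton (negProj e 0) := subsingleton_projSum (by ext; simp)
    have s0 : Subsingleton (posProj e 0) := subsingleton_projSum (by ext; simp)
    rcases hne with hne | hne
    · exact absurd (Function.LeftInverse.injective h₁).subsingleton
        (not_subsingleton_iff_nontrivial.mpr hne)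
    · exact absurd (Function.LeftInverse.injective h₀).subsingleton
        (not_subsingleton_iff_nontrivial.mpr hne)
  | add_left y hy f hf ih =>
    have hyf : IsDirectSum k e y f := IsDirectSum.closure_right
      (fun x hx y hy => (hd x hx y hy).coherent he) (fun x hx => hd y hy x hx) hf
    have hyi := hJ y hy
    rw [GenericallyIndecomposable, general_iff] at hyi
    refine (hyf.eventually_isom he rfl (p := fun b x => IsIndecomposable b ∧
      ∀ (h : Fin n → ℤ) (a : Pres e h), IsIndecomposable a → Retract a x → h ∈ J)
      ((tendsto_gen_fst.eventually hyi).and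
      (tendsto_gen_snd.eventually ih))).mono ?_
    rintro z ⟨b, x, ⟨hb, hx⟩, hz⟩ h a ha haz
    rcases ha.retract_or (haz.trans hz.retract) with h' | h'
    · exact eq_of_isom he (hb.isom_of_retract ha.1 h') ▸ hy
    · exact hx h a ha h'

end GVectors

/-! ### Transport of complexes along module decompositions. -/

section Isom

variable {Λ : Type*} [Ring Λ]
variable {P₁ P₀ Q₁ Q₀ X₁ X₀ Y₁ Y₀ : Type*}
  [AddCommGroup P₁] [Module Λ P₁] [AddCommGroup P₀] [Module Λ P₀]
  [AddCommGroup Q₁] [Module Λ Q₁] [AddCommGroup Q₀] [Module Λ Q₀]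
  [AddCommGroup X₁] [Module Λ X₁] [AddCommGroup X₀] [Module Λ X₀]
  [AddCommGroup Y₁] [Module Λ Y₁] [AddCommGroup Y₀] [Module Λ Y₀]

theorem Isom.prodMap {a : P₁ →ₗ[Λ] P₀} {b : Q₁ →ₗ[Λ] Q₀} {x : X₁ →ₗ[Λ] X₀} {y : Y₁ →ₗ[Λ] Y₀}
    (hax : Isom a x) (hby : Isom b y) : Isom (a.prodMap b) (x.prodMap y) := by
  obtain ⟨u₁, u₀, hu⟩ := hax
  obtain ⟨w₁, w₀, hw⟩ := hby
  exact ⟨u₁.prodCongr w₁, u₀.prodCongr w₀, fun v => by simp [hu, hw]⟩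

theorem exists_isom_of_equiv (a : P₁ →ₗ[Λ] P₀) (u₁ : P₁ ≃ₗ[Λ] X₁) (u₀ : P₀ ≃ₗ[Λ] X₀) :
    ∃ x : X₁ →ₗ[Λ] X₀, Isom a x :=
  ⟨u₀.toLinearMap ∘ₗ a ∘ₗ u₁.symm.toLinearMap, u₁, u₀, fun v => by simp⟩

theorem isom_prodMap_restrict {x : X₁ →ₗ[Λ] X₀} {A₁ B₁ : Submodule Λ X₁} {A₀ B₀ : Submodule Λ X₀}
    (h₁ : IsCompl A₁ B₁) (h₀ : IsCompl A₀ B₀) (hA : A₁.map x ≤ A₀) (hB : B₁.map x ≤ B₀) :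
    Isom x ((x.restrict (Submodule.map_le_iff_le_comap.mp hA)).prodMap
      (x.restrict (Submodule.map_le_iff_le_comap.mp hB))) :=
  Isom.symm ⟨Submodule.prodEquivOfIsCompl A₁ B₁ h₁, Submodule.prodEquivOfIsCompl A₀ B₀ h₀,
    fun v => by simp⟩

end Isom

/-! ### Tame g-vectors are sums of generically indecomposable ones. -/

section TameDecomposition

variable {k : Type*} [Field k] {Λ : Type*} [Ring Λ] [Algebra k Λ] {n : ℕ} {e : Fin n → Λ}

theorem nontrivial_projSum (he : IsBasicSystem e) {m : Fin n → ℕ} {i : Fin n} (h : 0 < m i) :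
    Nontrivial (projSum e m) := by
  obtain ⟨m', rfl⟩ := exists_eq_single_add h
  have := (isIndecomposableModule_proj (he.primitive i)).nontrivial
  exact (projSumCons e i m').toEquiv.nontrivial

theorem nontrivial_of_ne_zero (he : IsBasicSystem e) {f : Fin n → ℤ} (hf : f ≠ 0) :
    Nontrivial (negProj e f) ∨ Nontrivial (posProj e f) := by
  obtain ⟨i, hi⟩ := Function.ne_iff.mp hf
  rcases lt_or_gt_of_ne hi with h | h
  · exact Or.inl (nontrivial_projSum he (i := i) (by simpa using h))
  · exact Or.inr (nontrivial_projSum he (i := i) (by simpa using h))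

/-- A decomposition of an element of `Hom(f)` is given by elements of `Hom(g)` and `Hom(h)`
for a decomposition `f = g + h` without cancellation. -/
theorem exists_isom_of_isCompl (he : IsBasicSystem e) [IsNoetherianRing Λ] [IsArtinianRing Λ]
    {f : Fin n → ℤ} {x : Pres e f} {A₁ B₁ : Submodule Λ (negProj e f)}
    {A₀ B₀ : Submodule Λ (posProj e f)} (h₁ : IsCompl A₁ B₁) (h₀ : IsCompl A₀ B₀)
    (hA : A₁.map x ≤ A₀) (hB : B₁.map x ≤ B₀) :
    ∃ g h : Fin n → ℤ, f = g + h ∧ Coherent g h ∧ (g = 0 → A₁ = ⊥ ∧ A₀ = ⊥) ∧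
      (h = 0 → B₁ = ⊥ ∧ B₀ = ⊥) ∧
      ∃ (a : Pres e g) (b : Pres e h), Isom x (a.prodMap b) := by
  obtain ⟨m, m', hm, ⟨u⟩, ⟨u'⟩⟩ := exists_projSum_equiv he _
    (Submodule.prodEquivOfIsCompl A₁ B₁ h₁).symm
  obtain ⟨l, l', hl, ⟨w⟩, ⟨w'⟩⟩ := exists_projSum_equiv he _
    (Submodule.prodEquivOfIsCompl A₀ B₀ h₀).symm
  have hm' : ∀ i, (-f i).toNat = m i + m' i := fun i => congrFun hm i
  have hl' : ∀ i, (f i).toNat = l i + l' i := fun i => congrFun hl i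
  -- At each index one of P^{f+} and P^{f-} has multiplicity 0, so l and m have disjoint supports
  -- and are the positive and negative parts of l - m; likewise for l' and m'.
  let g : Fin n → ℤ := fun i => l i - m i
  let h : Fin n → ℤ := fun i => l' i - m' i
  have gm : m = fun i => (-g i).toNat := funext fun i => by
    have := hm' i; have := hl' i; simp only [g]; lia
  have gl : l = fun i => (g i).toNat := funext fun i => by
    have := hm' i; have := hl' i; simp only [g]; lia
  have gm' : m' = fun i => (-h i).toNat := funext fun i => by
    have := hm' i; have := hl' i; simp only [h]; lia
  have gl' : l' = fun i => (h i).toNat := funext fun i => by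
    have := hm' i; have := hl' i; simp only [h]; lia
  obtain ⟨a, ha⟩ := exists_isom_of_equiv (x.restrict (Submodule.map_le_iff_le_comap.mp hA))
    (u.trans (projSumCongr gm)) (w.trans (projSumCongr gl))
  obtain ⟨b, hb⟩ := exists_isom_of_equiv (x.restrict (Submodule.map_le_iff_le_comap.mp hB))
    (u'.trans (projSumCongr gm')) (w'.trans (projSumCongr gl'))
  have bot : ∀ {M : Type _} [AddCommGroup M] [Module Λ M] (C : Submodule Λ M) (r : Fin n → ℕ),
      (C ≃ₗ[Λ] projSum e r) → r = 0 → C = ⊥ := by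
    intro M _ _ C r E hr
    have := subsingleton_projSum (e := e) hr
    exact Submodule.subsingleton_iff_eq_bot.mp E.injective.subsingleton
  refine ⟨g, h, funext fun i => ?_, fun i => ?_, fun hg => ⟨?_, ?_⟩, fun hh => ⟨?_, ?_⟩, a, b,
    (isom_prodMap_restrict h₁ h₀ hA hB).trans (ha.prodMap hb)⟩
  · have := hm' i; have := hl' i; simp only [g, h, Pi.add_apply]; lia
  · have := hm' i; have := hl' i; simp only [g, h]; lia
  · exact bot _ _ u (by rw [gm, hg]; rfl)
  · exact bot _ _ w (by rw [gl, hg]; rfl)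
  · exact bot _ _ u' (by rw [gm', hh]; rfl)
  · exact bot _ _ w' (by rw [gl', hh]; rfl)

variable [Module.Finite k Λ] [IsAlgClosed k]

/-- Splittings f = g + h without cancellation satisfy |g i| ≤ |f i|, so there are finitely many. If
each were generically avoided, all would be at once, and general elements would be indecomposable.
-/
theorem exists_frequently_isom (he : IsBasicSystem e) {f : Fin n → ℤ} (hf : f ≠ 0)
    (hi : ¬GenericallyIndecomposable k e f) :
    ∃ g h : Fin n → ℤ, f = g + h ∧ Coherent g h ∧ g ≠ 0 ∧ h ≠ 0 ∧
      ∃ᶠ x in gen k (Pres e f), ∃ (a : Pres e g) (b : Pres e h), Isom x (a.prodMap b) := by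
  have := isNoetherianRing_of_moduleFinite k Λ
  have := isArtinianRing_of_moduleFinite k Λ
  by_contra! hcon
  apply hi
  rw [GenericallyIndecomposable, general_iff]
  let T : Finset (Fin n → ℤ) :=
    Fintype.piFinset fun i => Finset.Icc (-((f i).natAbs : ℤ)) (f i).natAbs
  have hT : ∀ᶠ x in gen k (Pres e f), ∀ g ∈ T, ∀ h, f = g + h → Coherent g h → g ≠ 0 → h ≠ 0 →
      ¬∃ (a : Pres e g) (b : Pres e h), Isom x (a.prodMap b) := by
    rw [eventually_all_finset]
    intro g _
    by_cases hg : Coherent g (f - g) ∧ g ≠ 0 ∧ f - g ≠ 0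
    · have := hcon g (f - g) (by abel) hg.1 hg.2.1 hg.2.2
      refine this.mono fun x hx h hfh _ _ _ => ?_
      obtain rfl : h = f - g := by rw [hfh]; abel
      rintro ⟨a, b, hab⟩
      exact hx a b hab
    · refine Eventually.of_forall fun x h hfh hc hg0 hh0 => (hg ?_).elim
      obtain rfl : h = f - g := by rw [hfh]; abel
      exact ⟨hc, hg0, hh0⟩
  refine hT.mono fun x hx => ⟨nontrivial_of_ne_zero he hf, ?_⟩
  intro A₁ B₁ A₀ B₀ h₁ h₀ hA hB
  obtain ⟨g, h, hfgh, hc, hg, hh, hab⟩ := exists_isom_of_isCompl he h₁ h₀ hA hB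
  by_contra! hne
  refine hx g ?_ h hfgh hc (fun h0 => ?_) (fun h0 => ?_) hab
  · rw [Fintype.mem_piFinset]
    intro i
    have := hc i
    have : f i = g i + h i := congrFun hfgh i
    rw [Finset.mem_Icc]
    omega
  · exact hne.1 (hg h0).1 (hg h0).2
  · exact hne.2 (hh h0).1 (hh h0).2

/-- Induction on ∑ |f i|. If f is not generically indecomposable, splittings of type g + h occur
densely and meet the open locus where extensions vanish, so g and h are tame and compatible. -/
theorem mem_closure_ind_of_isTame (he : IsBasicSystem e) {f : Fin n → ℤ} (hf : IsTame k e f) :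
    f ∈ AddSubmonoid.closure (ind k e f) := by
  induction hN : ∑ i, (f i).natAbs using Nat.strong_induction_on generalizing f with
  | _ N ih =>
  subst hN
  by_cases hf0 : f = 0
  · rw [hf0]
    exact zero_mem _
  by_cases hi : GenericallyIndecomposable k e f
  · exact AddSubmonoid.subset_closure
      ⟨hi, 0, (add_zero f).symm, eInvG_zero_right f, eInvG_zero_left f⟩
  obtain ⟨g, h, hfgh, hc, hg, hh, hfreq⟩ := exists_frequently_isom he hf0 hi
  obtain ⟨x₀, y₀, hxy₀⟩ := eInvG_eq_zero_iff.mp hf.1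
  -- Choose x first and then y, both split, with vanishing extensions from x to y: the four
  -- vanishings among g and h are its blocks.
  obtain ⟨x, ⟨a, b, hx⟩, hxy⟩ := (hfreq.and_eventually (eventually_extVanish_left hxy₀)).exists
  obtain ⟨y, ⟨a', b', hy⟩, hxy'⟩ := (hfreq.and_eventually (eventually_extVanish_right hxy)).exists
  have ha := (retract_prodMap_left a b).trans hx.symm.retract
  have hb := (retract_prodMap_right a b).trans hx.symm.retract
  have ha' := (retract_prodMap_left a' b').trans hy.symm.retract
  have hb' := (retract_prodMap_right a' b').trans hy.symm.retract
  have hgg : eInvG k e g g = 0 :=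
    eInvG_eq_zero_iff.mpr ⟨a, a', (hxy'.of_retract_left ha).of_retract_right ha'⟩
  have hgh : eInvG k e g h = 0 :=
    eInvG_eq_zero_iff.mpr ⟨a, b', (hxy'.of_retract_left ha).of_retract_right hb'⟩
  have hhg : eInvG k e h g = 0 :=
    eInvG_eq_zero_iff.mpr ⟨b, a', (hxy'.of_retract_left hb).of_retract_right ha'⟩
  have hhh : eInvG k e h h = 0 :=
    eInvG_eq_zero_iff.mpr ⟨b, b', (hxy'.of_retract_left hb).of_retract_right hb'⟩
  have hsum : ∑ i, (f i).natAbs = ∑ i, (g i).natAbs + ∑ i, (h i).natAbs := by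
    rw [← Finset.sum_add_distrib]
    refine Finset.sum_congr rfl fun i _ => ?_
    have := hc i
    have : f i = g i + h i := congrFun hfgh i
    lia
  have hpos : ∀ v : Fin n → ℤ, v ≠ 0 → 0 < ∑ i, (v i).natAbs := by
    intro v hv
    obtain ⟨i, hi⟩ := Function.ne_iff.mp hv
    exact Finset.sum_pos' (fun _ _ => Nat.zero_le _) ⟨i, Finset.mem_univ i, by simpa using hi⟩
  have hgpos := hpos g hg
  have hhpos := hpos h hh
  have hgs : IsSummand k e g f := ⟨h, hfgh, hgh, hhg⟩
  have hhs : IsSummand k e h f := ⟨g, by rw [hfgh, add_comm], hhg, hgh⟩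
  have h1 := ih _ (by lia) (f := g) ⟨hgg, hgg⟩ rfl
  have h2 := ih _ (by lia) (f := h) ⟨hhh, hhh⟩ rfl
  have hadd := add_mem
    (AddSubmonoid.closure_mono (t := ind k e f) (fun x hx => ⟨hx.1, hx.2.trans he hgs⟩) h1)
    (AddSubmonoid.closure_mono (t := ind k e f) (fun x hx => ⟨hx.1, hx.2.trans he hhs⟩) h2)
  rwa [← hfgh] at hadd

end TameDecomposition

/-! ### Linear relations among generically indecomposable summands. -/

section LinearIndependence

variable {k : Type*} [Field k] [IsAlgClosed k] {Λ : Type*} [Ring Λ] [Algebra k Λ]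
  [Module.Finite k Λ] {n : ℕ} {e : Fin n → Λ}

theorem coherent_of_mem_ind (he : IsBasicSystem e) {g x y : Fin n → ℤ} (hx : x ∈ ind k e g)
    (hy : y ∈ ind k e g) : Coherent x y := by
  by_cases h : x = y
  · exact h ▸ Coherent.refl x
  · exact (isDirectSum_of_mem_ind he hx hy h).coherent he

/-- A summand occurring in a linear relation lies in its own cone `D`. -/
theorem mem_D_of_relation (he : IsBasicSystem e) {g y r : Fin n → ℤ} (hy : y ∈ ind k e g) {c : ℕ}
    (hc : 0 < c) (hr : r ∈ AddSubmonoid.closure (ind k e g \ {y}))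
    (hf : c • y + r ∈ AddSubmonoid.closure (ind k e g \ {y})) : y ∈ D k e y := by
  have hcoh : ∀ x ∈ ind k e g \ {y}, ∀ z ∈ ind k e g \ {y}, Coherent x z :=
    fun x hx z hz => coherent_of_mem_ind he hx.1 hz.1
  have hd : ∀ x ∈ ind k e g \ {y}, IsDirectSum k e y x :=
    fun x hx => isDirectSum_of_mem_ind he hy hx.1 (Ne.symm hx.2)
  have hyf := IsDirectSum.closure_right hcoh hd hf
  have hyr := ((IsDirectSum.closure_right hcoh hd hr).symm.nsmul_right c).symm
  have hs : IsSummand k e (c • y) (c • y + r) := ⟨r, rfl, hyr⟩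
  exact ⟨c, hc, hs.isDirectSum_right he hyf⟩

/-- Generically indecomposable g-vectors in a relation between tame summands are unique. -/
theorem mem_of_add_mem_closure (he : IsBasicSystem e) {J : Set (Fin n → ℤ)}
    (hJ : ∀ x ∈ J, GenericallyIndecomposable k e x) (hd : ∀ x ∈ J, ∀ y ∈ J, IsDirectSum k e x y)
    {x r : Fin n → ℤ} (hx : GenericallyIndecomposable k e x) (hxr : IsDirectSum k e x r)
    (hf : x + r ∈ AddSubmonoid.closure J) : x ∈ J := by
  rw [GenericallyIndecomposable, general_iff] at hx
  obtain ⟨z, h1, a, c, ha, hz⟩ := ((eventually_mem_of_retract he hJ hd hf).and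
    (hxr.eventually_isom he rfl (p := fun a _ => IsIndecomposable a)
      (tendsto_gen_fst.eventually hx))).exists
  exact h1 x a ha ((retract_prodMap_left a c).trans hz.symm.retract)

/-- The part of a linear combination of given sign lies in the additive closure. -/
theorem sum_toNat_mem_closure {S : Set (Fin n → ℤ)} (t : Finset (Fin n → ℤ))
    (c : (Fin n → ℤ) → ℤ) (h : ∀ y ∈ t, 0 < c y → y ∈ S) :
    ∑ y ∈ t, (c y).toNat • y ∈ AddSubmonoid.closure S := by
  refine sum_mem fun y hy => ?_
  by_cases hc : 0 < c y
  · exact nsmul_mem (AddSubmonoid.subset_closure (h y hy hc)) _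
  · rw [Int.toNat_of_nonpos (not_lt.mp hc), zero_smul]
    exact zero_mem _

theorem sum_toNat_eq {t : Finset (Fin n → ℤ)} {c : (Fin n → ℤ) → ℤ}
    (h : ∑ y ∈ t, c y • y = 0) :
    ∑ y ∈ t, (c y).toNat • y = ∑ y ∈ t, (-c y).toNat • y := by
  rw [← sub_eq_zero, ← Finset.sum_sub_distrib, ← h]
  refine Finset.sum_congr rfl fun y _ => ?_
  rw [← natCast_zsmul, ← natCast_zsmul, ← sub_smul]
  congr 1
  lia

/-- After separating signs, y occurs on the positive side only, so `mem_D_of_relation` puts y in its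
own D, which the condition forbids for wild y. -/
theorem isTame_of_relation (he : IsBasicSystem e) {g : Fin n → ℤ} (hg : NonDecreasing k e g)
    {t : Finset (Fin n → ℤ)} (ht : ↑t ⊆ ind k e g) {c : (Fin n → ℤ) → ℤ}
    (h : ∑ y ∈ t, c y • y = 0) {y : Fin n → ℤ} (hy : y ∈ t) (hcy : 0 < c y) : IsTame k e y := by
  by_contra hw
  refine hg y (ht hy) hw (mem_D_of_relation he (ht hy) (c := (c y).toNat)
    (r := ∑ z ∈ t.erase y, (c z).toNat • z) (by lia) ?_ ?_)
  · exact sum_toNat_mem_closure _ _ fun z hz _ =>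
      ⟨ht (Finset.mem_of_mem_erase hz), Finset.ne_of_mem_erase hz⟩
  · rw [Finset.add_sum_erase t (fun z => (c z).toNat • z) hy, sum_toNat_eq h]
    refine sum_toNat_mem_closure _ (fun z => -c z) fun z hz hcz => ⟨ht hz, ?_⟩
    rintro rfl
    lia

theorem NonDecreasing.linearIndepOn (he : IsBasicSystem e) {g : Fin n → ℤ}
    (hg : NonDecreasing k e g) : LinearIndepOn ℤ id (ind k e g) := by
  rw [linearIndepOn_iff']
  intro t c ht h x hx
  by_contra hcx
  wlog hpos : 0 < c x generalizing c
  · refine this (-c) ?_ ?_ ?_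
    · simpa using h
    · simpa using hcx
    · simp only [Pi.neg_apply]
      lia
  simp only [id] at h
  have hneg : ∑ y ∈ t, (-c y) • y = 0 := by simpa using h
  let K : Set (Fin n → ℤ) := {y | y ∈ ind k e g ∧ IsTame k e y}
  have hK : ∀ y ∈ K, ∀ z ∈ K, IsDirectSum k e y z := by
    intro y hy z hz
    by_cases hyz : y = z
    · exact hyz ▸ hy.2
    · exact isDirectSum_of_mem_ind he hy.1 hz.1 hyz
  have hKc : ∀ y ∈ K, ∀ z ∈ K, Coherent y z := fun y hy z hz => (hK y hy z hz).coherent he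
  have hxK : x ∈ K := ⟨ht hx, isTame_of_relation he hg ht h hx hpos⟩
  -- Peel one copy of x off the positive side; the rest is compatible with x since all vectors
  -- involved are tame.
  have hr : (c x).toNat.pred • x + ∑ z ∈ t.erase x, (c z).toNat • z ∈ AddSubmonoid.closure K := by
    refine add_mem (nsmul_mem (AddSubmonoid.subset_closure hxK) _)
      (sum_toNat_mem_closure _ _ fun z hz hcz => ?_)
    have hzt := Finset.mem_of_mem_erase hz
    exact ⟨ht hzt, isTame_of_relation he hg ht h hzt hcz⟩
  have hxr := IsDirectSum.closure_right hKc (hK x hxK) hr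
  -- The negative side does not involve x, yet x must occur in it as an indecomposable summand of a
  -- general element.
  have hmem : x ∈ K \ {x} := by
    refine mem_of_add_mem_closure he (J := K \ {x}) (fun y hy => hy.1.1.1)
      (fun y hy z hz => hK y hy.1 z hz.1) (ht hx).1 hxr ?_
    have hsucc : x + (c x).toNat.pred • x = (c x).toNat • x := by
      rw [← succ_nsmul', ← Nat.succ_eq_add_one, Nat.succ_pred_eq_of_pos (n := (c x).toNat) (by lia)]
    rw [← add_assoc, hsucc, Finset.add_sum_erase t (fun z => (c z).toNat • z) hx, sum_toNat_eq h]
    refine sum_toNat_mem_closure _ (fun z => -c z) fun z hz hcz =>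
      ⟨⟨ht hz, isTame_of_relation he hg ht hneg hz hcz⟩, ?_⟩
    rintro rfl
    lia
  exact hmem.2 rfl

/-- A wild summand lying in its own cone `D` makes some multiple have dependent summands. -/
theorem exists_not_linearIndepOn (he : IsBasicSystem e) {f h : Fin n → ℤ} (hh : h ∈ ind k e f)
    (hw : IsWild k e h) (hD : h ∈ D k e h) :
    ∃ N : ℕ, 0 < N ∧ ¬LinearIndepOn ℤ id (ind k e (N • f)) := by
  obtain ⟨s, hs, hsh⟩ := hD
  obtain ⟨hi, h', rfl, hhh'⟩ := hh
  -- The multiple s + 1 leaves room for both h and s h: (s+1)(h + h') = h + s h + (s+1)h'.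
  refine ⟨s + 1, Nat.succ_pos s, fun hli => ?_⟩
  have hFF : IsTame k e (s • h) := hsh.symm.nsmul_right s
  have hFh' : IsDirectSum k e (s • h) ((s + 1) • h') :=
    (hhh'.nsmul_right (s + 1)).symm.nsmul_right s |>.symm
  have hhN := hhh'.nsmul_right (s + 1)
  have hF : IsSummand k e (s • h) ((s + 1) • (h + h')) :=
    ⟨h + (s + 1) • h', by rw [nsmul_add, succ_nsmul, add_assoc],
      hsh.symm.add_right (hhN.coherent he) hFh'⟩
  have hmem : h ∈ ind k e ((s + 1) • (h + h')) :=
    ⟨hi, s • h + (s + 1) • h', by rw [nsmul_add, succ_nsmul', add_assoc],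
      hsh.add_right (hFh'.coherent he) hhN⟩
  -- Were h a summand of the tame s h, it would be compatible with itself, contradicting wildness.
  have hsub : ind k e (s • h) ⊆ ind k e ((s + 1) • (h + h')) \ {h} := by
    refine fun y hy => ⟨⟨hy.1, hy.2.trans he hF⟩, ?_⟩
    rintro rfl
    exact hw (hy.2.isDirectSum_right he (hy.2.isDirectSum_right he hFF).symm)
  have hspan : s • h ∈ Submodule.span ℤ (ind k e ((s + 1) • (h + h')) \ {h}) := by
    have h1 := AddSubmonoid.closure_mono hsub (mem_closure_ind_of_isTame he hFF)
    have h2 : AddSubmonoid.closure (ind k e ((s + 1) • (h + h')) \ {h}) ≤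
        (Submodule.span ℤ (ind k e ((s + 1) • (h + h')) \ {h})).toAddSubmonoid :=
      AddSubmonoid.closure_le.mpr Submodule.subset_span
    exact h2 h1
  -- Independence would force s = 0.
  have := linearIndependent_iff_eq_zero_of_smul_mem_span.mp hli ⟨h, hmem⟩ (s : ℤ) (by
    convert hspan using 1
    · simp
    · congr 1)
  lia

end LinearIndependence

end GVector

/-! ### The three statements assembled. -/

theorem mainTheorem4 {k Λ : Type*} [Field k] [IsAlgClosed k] [Ring Λ] [Algebra k Λ]
    [Module.Finite k Λ] {n : ℕ} (e : Fin n → Λ) (he : GVector.IsBasicSystem e) :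
    (∀ g : Fin n → ℤ, GVector.NonDecreasing k e g →
      LinearIndepOn ℤ id (GVector.ind k e g) ∧ (GVector.ind k e g).encard ≤ n) ∧
    (∀ g : Fin n → ℤ,
      (∀ t : ℕ, 0 < t → LinearIndepOn ℤ id (GVector.ind k e (t • g))) ↔
        ∀ t : ℕ, 0 < t → GVector.NonDecreasing k e (t • g)) ∧
    (GVector.AlgebraNonDecreasing k e ↔
      ∀ g : Fin n → ℤ, LinearIndepOn ℤ id (GVector.ind k e g)) := by
  have hb : ∀ g : Fin n → ℤ,
      (∀ t : ℕ, 0 < t → LinearIndepOn ℤ id (GVector.ind k e (t • g))) →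
        ∀ t : ℕ, 0 < t → GVector.NonDecreasing k e (t • g) := by
    intro g hg t ht h hh hw hD
    obtain ⟨N, hN, hdep⟩ := GVector.exists_not_linearIndepOn he hh hw hD
    rw [← mul_nsmul'] at hdep
    exact hdep (hg _ (Nat.mul_pos hN ht))
  refine ⟨fun g hg => ⟨hg.linearIndepOn he, ?_⟩, fun g => ⟨hb g, fun hg t ht =>
    (hg t ht).linearIndepOn he⟩, fun hA g => (hA g).linearIndepOn he, fun hli g => ?_⟩
  · simpa using (hg.linearIndepOn he).encard_le_toENat_rank
  · simpa using hb g (fun t _ => hli (t • g)) 1 one_pos
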